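/- Let $\mathbb K$ be a field of characteristic $0$ with algebraic closure $\overline{\mathbb K}$, let $a,b\ge 1$ be integers, and let $\mathcal S\subset\mathbb Z$ be a finite set with $\max\mathcal S=a$ and $\min\mathcal S=-b$. Let each $s\in\mathcal S$ carry a weight $\omega_s\in\mathbb K$, with $\omega_a\ne 0$ and $\omega_{-b}\neq 0$. An excursion is a sequence $(s_1,\dots,s_n)\in\mathcal S^n$, $n\ge 0$, all of whose partial sums $s_1+\cdots+s_i$ are non-negative and such that $s_1+\cdots+s_n=0$; let $$E=\sum \omega_{s_1}\cdots\omega_{s_n}\,t^n\in\mathbb K[[t]],$$ the sum running over all excursions. Put $P(u)=\sum_{s\in\mathcal S}\omega_su^s$ and $K(u)=u^b(1-tP(u))\in\mathbb K[t][u]$. (i) $E$ is algebraic over $\mathbb K(t)$, of degree at most $\binom{a+b}{a}$. (ii) Counted with multiplicity, $K(u)$ has $a+b$ roots $U_1,\dots,U_{a+b}$ in the field of Puiseux series in $t$ with coefficients in $\overline{\mathbb K}$. Exactly $b$ of them, say $U_1,\dots,U_b$, are finite at $t=0$, that is, involve no negative power of $t$ (the small roots); the other $a$, $U_{b+1},\dots,U_{a+b}$,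 are the large roots. For every such labelling, $$E=\frac{(-1)^{b+1}}{t\,\omega_{-b}}\prod_{i=1}^bU_i=\frac{(-1)^{a+1}}{t\,\omega_a}\prod_{i=b+1}^{a+b}\frac1{U_i}.$$ (iii) With $U_I=\prod_{i\in I}U_i$, the quantity $$D(t,z)=\prod_{I\subset\{1,\dots,a+b\},\ |I|=a}\bigl(1+(-1)^a\,z\,t\,\omega_a\,U_I\bigr)$$ is a polynomial in $t$ and $z$ with coefficients in $\mathbb K$, of degree $\binom{a+b}{a}$ in $z$, and $D(t,E)=0$. -/

import Mathlib

namespace DiscreteExcursion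

open scoped Polynomial PowerSeries

noncomputable section

/-! ### Excursions and their generating function -/

/-- A sequence `(s₁, …, sₙ)` of integer steps is an excursion if all its partial sums are
non-negative and its total sum is `0`. -/
def IsExcursion {n : ℕ} (s : Fin n → ℤ) : Prop :=
  (∀ i : Fin n, 0 ≤ ∑ j ∈ Finset.Iic i, s j) ∧ ∑ j, s j = 0

open Classical in
/-- The generating function `E = ∑ ω_{s₁} ⋯ ω_{sₙ} tⁿ ∈ 𝕂⟦t⟧`, the sum running over all
excursions `(s₁, …, sₙ)` with steps in `S`. -/
def excursionSeries {K : Type*} [Field K] (S : Finset ℤ) (ω : ℤ → K) : K⟦X⟧ :=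
  PowerSeries.mk fun n =>
    ∑ s ∈ (Fintype.piFinset fun _ : Fin n => S) with IsExcursion s, ∏ i, ω (s i)

/-! ### The kernel -/

/-- The kernel `K(u) = u^b (1 - t P(u)) = u^b - t ∑_{s ∈ S} ω_s u^{s+b}`, as a polynomial in `u`
(outer variable) over `𝕂[t]`. It is used when `-b = min S`, so that all exponents `s + b` are
non-negative and `Int.toNat` does not truncate. -/
def kernel {K : Type*} [Field K] (S : Finset ℤ) (ω : ℤ → K) (b : ℕ) : K[X][X] :=
  Polynomial.X ^ b - Polynomial.C Polynomial.X *
    ∑ s ∈ S, Polynomial.C (Polynomial.C (ω s)) * Polynomial.X ^ (s + (b : ℤ)).toNat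

/-! ### The field of Puiseux series -/

/-- A Hahn series with rational exponents is a Puiseux series if its exponents have a common
denominator. (Being well-ordered, the set of exponents is then bounded below.) -/
def IsPuiseux {L : Type*} [Field L] (f : HahnSeries ℚ L) : Prop :=
  ∃ n : ℕ, 0 < n ∧ ∀ q : ℚ, f.coeff q ≠ 0 → ∃ k : ℤ, q * n = k

/-- The additive map `k ↦ k / n` from `ℤ` to `ℚ`. -/
def divHom (n : ℕ) : ℤ →+ ℚ where
  toFun k := k / n
  map_zero' := by simp
  map_add' x y := by push_cast; ring

theorem divHom_le_iff {n : ℕ} (hn : 0 < n) (x y : ℤ) : divHom n x ≤ divHom n y ↔ x ≤ y := by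
  have : (0 : ℚ) < n := by exact_mod_cast hn
  simp [divHom, div_le_div_iff_of_pos_right this]

theorem divHom_injective {n : ℕ} (hn : 0 < n) : Function.Injective (divHom n) := fun x y h =>
  le_antisymm ((divHom_le_iff hn x y).1 h.le) ((divHom_le_iff hn y x).1 h.ge)

/-- The embedding of Laurent series in `t` into Hahn series that sends `t` to `t^{1/n}`. -/
def ramify (L : Type*) [Field L] {n : ℕ} (hn : 0 < n) : HahnSeries ℤ L →+* HahnSeries ℚ L :=
  HahnSeries.embDomainRingHom (divHom n) (divHom_injective hn) (divHom_le_iff hn)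

/-- Puiseux series are exactly the Laurent series in some `t^{1/n}`. -/
theorem isPuiseux_iff {L : Type*} [Field L] (f : HahnSeries ℚ L) :
    IsPuiseux f ↔ ∃ (n : ℕ) (hn : 0 < n), f ∈ (ramify L hn).range := by
  constructor
  · rintro ⟨n, hn, h⟩
    refine ⟨n, hn, ⟨fun k => f.coeff (divHom n k), ?_⟩, ?_⟩
    · intro g
      obtain ⟨i, j, hij, hle⟩ := f.isPWO_support fun m => ⟨divHom n (g m), (g m).2⟩
      exact ⟨i, j, hij, (divHom_le_iff hn _ _).1 hle⟩
    · ext q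
      by_cases hq : ∃ k : ℤ, divHom n k = q
      · obtain ⟨k, rfl⟩ := hq
        exact HahnSeries.embDomain_coeff
          (f := ⟨⟨divHom n, divHom_injective hn⟩, divHom_le_iff hn _ _⟩) (a := k)
      · have h0 : f.coeff q = 0 := by
          by_contra h0
          obtain ⟨k, hk⟩ := h q h0
          refine hq ⟨k, ?_⟩
          have : (n : ℚ) ≠ 0 := by exact_mod_cast hn.ne'
          simp only [divHom, AddMonoidHom.coe_mk, ZeroHom.coe_mk]
          rw [← hk]
          field_simp
        rw [h0]
        refine HahnSeries.embDomain_of_notMem_range ?_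
        rintro ⟨k, hk⟩
        exact hq ⟨k, hk⟩
  · rintro ⟨n, hn, x, rfl⟩
    refine ⟨n, hn, fun q hq => ?_⟩
    by_contra hk
    refine hq (HahnSeries.embDomain_of_notMem_range ?_)
    rintro ⟨k, rfl⟩
    refine hk ⟨k, ?_⟩
    have : (n : ℚ) ≠ 0 := by exact_mod_cast hn.ne'
    change (k : ℚ) / n * n = k
    field_simp

/-- The field of Puiseux series in `t` with coefficients in the field `L`. -/
def puiseuxField (L : Type*) [Field L] : Subfield (HahnSeries ℚ L) where
  carrier := {f | IsPuiseux f}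
  zero_mem' := ⟨1, one_pos, fun q hq => absurd HahnSeries.coeff_zero hq⟩
  one_mem' := (isPuiseux_iff _).2 ⟨1, one_pos, one_mem _⟩
  add_mem' := by
    rintro f g ⟨n, hn, hf⟩ ⟨m, hm, hg⟩
    refine ⟨n * m, Nat.mul_pos hn hm, fun q hq => ?_⟩
    by_cases h : f.coeff q = 0
    · have h' : g.coeff q ≠ 0 := fun h' => hq (by simp [h, h'])
      obtain ⟨k, hk⟩ := hg q h'
      exact ⟨k * n, by push_cast; rw [← hk]; ring⟩
    · obtain ⟨k, hk⟩ := hf q h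
      exact ⟨k * m, by push_cast; rw [← hk]; ring⟩
  mul_mem' := by
    rintro f g ⟨n, hn, hf⟩ ⟨m, hm, hg⟩
    refine ⟨n * m, Nat.mul_pos hn hm, fun q hq => ?_⟩
    rw [HahnSeries.coeff_mul] at hq
    obtain ⟨⟨i, j⟩, hij, _⟩ := Finset.exists_ne_zero_of_sum_ne_zero hq
    obtain ⟨hi, hj, hsum⟩ := Finset.mem_antidiagonal.1 hij
    obtain ⟨k, hk⟩ := hf i hi
    obtain ⟨l, hl⟩ := hg j hj
    refine ⟨k * m + l * n, ?_⟩
    push_cast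
    rw [← hk, ← hl, ← hsum]
    ring
  neg_mem' := by
    rintro f ⟨n, hn, hf⟩
    exact ⟨n, hn, fun q hq => hf q fun h => hq (by simp [h])⟩
  inv_mem' := by
    intro f hf
    obtain ⟨n, hn, x, rfl⟩ := (isPuiseux_iff f).1 hf
    exact (isPuiseux_iff _).2 ⟨n, hn, x⁻¹, map_inv₀ _ _⟩

/-- The type of Puiseux series in `t` with coefficients in `L`; it is a field. -/
abbrev PuiseuxSeries (L : Type*) [Field L] : Type _ := puiseuxField L

theorem isPuiseux_ofPowerSeries {L : Type*} [Field L] (f : L⟦X⟧) :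
    IsPuiseux (HahnSeries.ofPowerSeries ℚ L f) := by
  refine ⟨1, one_pos, fun q hq => ?_⟩
  by_contra hk
  refine hq ?_
  rw [HahnSeries.ofPowerSeries_apply]
  refine HahnSeries.embDomain_of_notMem_range ?_
  rintro ⟨k, rfl⟩
  exact hk ⟨k, by simp⟩

/-- The embedding of `𝕂⟦t⟧` into the field of Puiseux series in `t` over an extension `L`
of `𝕂`. -/
def toPuiseux (K L : Type*) [Field K] [Field L] [Algebra K L] : K⟦X⟧ →+* PuiseuxSeries L :=
  ((HahnSeries.ofPowerSeries ℚ L).comp (PowerSeries.map (algebraMap K L))).codRestrict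
    (puiseuxField L) fun f => isPuiseux_ofPowerSeries (PowerSeries.map (algebraMap K L) f)

/-- The embedding of `𝕂[t]` into the field of Puiseux series in `t` over an extension `L`
of `𝕂`. -/
def polyToPuiseux (K L : Type*) [Field K] [Field L] [Algebra K L] : K[X] →+* PuiseuxSeries L :=
  (toPuiseux K L).comp Polynomial.coeToPowerSeries.ringHom

/-- A Puiseux series is finite at `t = 0` if it involves no negative power of `t`. -/
def FiniteAtZero {L : Type*} [Field L] (f : PuiseuxSeries L) : Prop :=
  ∀ q : ℚ, q < 0 → (f : HahnSeries ℚ L).coeff q = 0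

/-! ### The small and large roots of the kernel -/

/-- `U₁, …, U_{a+b}` (indexed from `0`) are the roots of the kernel in the field of Puiseux series
over `L`, listed with multiplicity, the first `b` of them being the small ones (finite at `t = 0`)
and the other `a` the large ones (infinite at `t = 0`). -/
structure IsRootLabelling {K L : Type*} [Field K] [Field L] [Algebra K L]
    (S : Finset ℤ) (ω : ℤ → K) (a b : ℕ) (U : Fin (a + b) → PuiseuxSeries L) : Prop where
  roots_eq : ((kernel S ω b).map (polyToPuiseux K L)).roots = Finset.univ.val.map U
  small : ∀ i : Fin (a + b), (i : ℕ) < b → FiniteAtZero (U i)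
  large : ∀ i : Fin (a + b), b ≤ (i : ℕ) → ¬ FiniteAtZero (U i)

/-- `∏_{I ⊆ {1, …, a+b}, |I| = a} (1 + (-1)^a z t ω_a U_I)` with `U_I = ∏_{i ∈ I} U_i`, as a
polynomial in `z` over the field of Puiseux series in `t`. -/
def productD {K L : Type*} [Field K] [Field L] [Algebra K L] (ω : ℤ → K) (a b : ℕ)
    (U : Fin (a + b) → PuiseuxSeries L) : (PuiseuxSeries L)[X] :=
  ∏ I ∈ Finset.powersetCard a (Finset.univ : Finset (Fin (a + b))),
    (1 + Polynomial.C ((-1) ^ a * toPuiseux K L PowerSeries.X *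
      toPuiseux K L (PowerSeries.C (ω a)) * ∏ i ∈ I, U i) * Polynomial.X)

end

end DiscreteExcursion

/-! This is the kernel method. Write Q = u^b P, and let F_n(u) count the walks of length n on the
non-negative integers by endpoint. Adding a step multiplies F_n by P and discards the negative
exponents, so u^b F_{n+1} = Q F_n - R_n with deg R_n < b. At a root u of the kernel, u^b = t Q(u),
and the sum over n < M telescopes (`kernel_equation`) to u^b - ∑ t^{n+1} R_n(u) = t^M u^b F_M(u). If
u is finite at t = 0, the right side tends to 0 t-adically. Each small root is thus a root of
`smallFactor`, the monic polynomial u^b - ∑ t^{n+1} R_n(u) of degree b over 𝕂⟦t⟧. It has b distinct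
small roots, hence equals the product of the u - U_i. Its constant term is -t ω_{-b} E, which gives
the first formula; Vieta for the kernel turns it into the second.

The roots are constructed. Putting u = s v with s^b = t gives v^b = Q(s v), and Hensel's lemma lifts
each b-th root of Q(0) (`exists_powerSeries_pow_eq`). The large roots are inverses of small roots of
the reversed equation. These a + b distinct roots exhaust the degree of the kernel.

The coefficients of D in z are symmetric in the roots, hence Laurent polynomials in t. They are also
finite at t = 0, because every t ω_a U_I is (`mul_prod_mem_finiteSubring`); so they are polynomials.
The factor of D indexed by the large roots vanishes at z = E, and D bounds the degree of E. -/

namespace DiscreteExcursion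

open scoped Polynomial PowerSeries

noncomputable section

/-! ### Walks on the half-line -/

section Walks

open Finset

variable {K : Type*} [Field K] (S : Finset ℤ) (ω : ℤ → K) (b : ℕ)

open Classical in
/-- The total weight of the walks of length `n` on the non-negative integers from `0` to `k`. -/
def walkSum (n : ℕ) (k : ℤ) : K :=
  ∑ s ∈ (Fintype.piFinset fun _ : Fin n => S) with
    (∀ i : Fin n, 0 ≤ ∑ j ∈ Finset.Iic i, s j) ∧ ∑ j, s j = k, ∏ i, ω (s i)

theorem coeff_excursionSeries (n : ℕ) :
    PowerSeries.coeff n (excursionSeries S ω) = walkSum S ω n 0 := by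
  rw [excursionSeries, PowerSeries.coeff_mk, walkSum]
  exact Finset.sum_congr (by ext s; simp only [Finset.mem_filter]; rfl) fun _ _ => rfl

theorem walkSum_zero (k : ℤ) : walkSum S ω 0 k = if k = 0 then 1 else 0 := by
  classical
  rw [walkSum]
  by_cases hk : k = 0 <;> simp [hk, eq_comm]

/-- Remove the last step. The last partial sum is the endpoint k itself, so its sign condition reads
0 ≤ k and the other conditions concern only the shortened walk. -/
theorem walkSum_succ (n : ℕ) (k : ℤ) :
    walkSum S ω (n + 1) k = if 0 ≤ k then ∑ x ∈ S, ω x * walkSum S ω n (k - x) else 0 := by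
  classical
  have key : ∀ s : Fin (n + 1) → ℤ,
      ((∀ i, 0 ≤ ∑ j ∈ Finset.Iic i, s j) ∧ ∑ j, s j = k) ↔
      (0 ≤ k ∧ (∀ i, 0 ≤ ∑ j ∈ Finset.Iic i, Fin.init s j) ∧
        ∑ j, Fin.init s j = k - s (Fin.last n)) := by
    intro s
    rw [Fin.forall_fin_succ', Fin.sum_univ_castSucc]
    have h1 : Finset.Iic (Fin.last n) = univ := by ext; simp [Fin.le_last]
    simp only [Fin.sum_Iic_castSucc, h1, Fin.init, Fin.sum_univ_castSucc]
    constructor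
    · rintro ⟨⟨h, h'⟩, rfl⟩
      exact ⟨h', h, by ring⟩
    · rintro ⟨h, h', h''⟩
      rw [h'']
      exact ⟨⟨h', by simpa using h⟩, by ring⟩
  have hS : (Fintype.piFinset fun _ : Fin (n + 1) => S) =
      (S ×ˢ (Fintype.piFinset fun _ : Fin n => S)).map
        (Fin.snocEquiv fun _ => ℤ).toEmbedding := by
    simpa [Fin.init_def] using Finset.filter_piFinset_eq_map_snocEquiv
      (S := fun _ : Fin (n + 1) => S) (P := fun _ => True)
  rw [walkSum, Finset.sum_filter, hS, Finset.sum_map, Finset.sum_product]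
  simp only [key]
  split_ifs with hk
  · refine Finset.sum_congr rfl fun x _ => ?_
    rw [walkSum, Finset.sum_filter, Finset.mul_sum]
    refine Finset.sum_congr rfl fun s _ => ?_
    simp [Fin.snocEquiv, hk, Fin.prod_univ_castSucc, mul_comm]
  · simp [hk]

theorem walkSum_of_neg (n : ℕ) {k : ℤ} (hk : k < 0) : walkSum S ω n k = 0 := by
  cases n with
  | zero => rw [walkSum_zero, if_neg hk.ne]
  | succ n => rw [walkSum_succ, if_neg hk.not_ge]

/-- The polynomial `u^b P(u)`. -/
def stepPoly : K[X] := ∑ s ∈ S, Polynomial.C (ω s) * Polynomial.X ^ (s + (b : ℤ)).toNat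

/-- The generating polynomial of the walks of length `n` on the non-negative integers starting
from `0`, counted by the position of their endpoint. -/
def walkPoly : ℕ → K[X]
  | 0 => 1
  | n + 1 => (stepPoly S ω b * walkPoly n) /ₘ Polynomial.X ^ b

/-- The part of `u^b P(u) F_n(u)` recording the steps that leave the non-negative integers. -/
def walkRem (n : ℕ) : K[X] := (stepPoly S ω b * walkPoly S ω b n) %ₘ Polynomial.X ^ b

theorem walkRem_add_walkPoly_succ (n : ℕ) :
    walkRem S ω b n + Polynomial.X ^ b * walkPoly S ω b (n + 1) =
      stepPoly S ω b * walkPoly S ω b n :=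
  Polynomial.modByMonic_add_div _ _

theorem degree_walkRem_lt (n : ℕ) : (walkRem S ω b n).degree < b := by
  simpa [walkRem] using Polynomial.degree_modByMonic_lt (stepPoly S ω b * walkPoly S ω b n)
    (Polynomial.monic_X_pow b)

theorem coeff_walkRem {n j : ℕ} (hj : j < b) :
    (walkRem S ω b n).coeff j = (stepPoly S ω b * walkPoly S ω b n).coeff j := by
  rw [← walkRem_add_walkPoly_succ, Polynomial.coeff_add, Polynomial.coeff_X_pow_mul',
    if_neg hj.not_ge, add_zero]

theorem coeff_walkPoly_succ (n k : ℕ) :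
    (walkPoly S ω b (n + 1)).coeff k = (stepPoly S ω b * walkPoly S ω b n).coeff (k + b) := by
  rw [← walkRem_add_walkPoly_succ, Polynomial.coeff_add, Polynomial.coeff_X_pow_mul,
    right_eq_add]
  exact Polynomial.coeff_eq_zero_of_degree_lt <| (degree_walkRem_lt S ω b n).trans_le (by exact_mod_cast Nat.le_add_left b k)

variable {S b}

theorem coeff_walkPoly (hS : ∀ s ∈ S, -(b : ℤ) ≤ s) (n k : ℕ) :
    (walkPoly S ω b n).coeff k = walkSum S ω n k := by
  induction n generalizing k with
  | zero => simp [walkPoly, walkSum_zero, Polynomial.coeff_one]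
  | succ n ih =>
    rw [coeff_walkPoly_succ, walkSum_succ, if_pos (by positivity), stepPoly, Finset.sum_mul,
      Polynomial.finsetSum_coeff]
    refine Finset.sum_congr rfl fun s hs => ?_
    rw [mul_assoc, Polynomial.coeff_C_mul, Polynomial.coeff_X_pow_mul']
    congr 1
    have := hS s hs
    split_ifs with h
    · rw [ih]
      congr 1
      omega
    -- Here the step s would have to start from the negative position k - s, where no walk ends.
    · rw [walkSum_of_neg]
      omega

theorem coeff_excursionSeries_eq_walkPoly (hS : ∀ s ∈ S, -(b : ℤ) ≤ s) (n : ℕ) :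
    PowerSeries.coeff n (excursionSeries S ω) = (walkPoly S ω b n).coeff 0 := by
  rw [coeff_excursionSeries, coeff_walkPoly ω hS]
  rfl

theorem constantCoeff_excursionSeries :
    PowerSeries.constantCoeff (excursionSeries S ω) = 1 := by
  rw [← PowerSeries.coeff_zero_eq_constantCoeff_apply, coeff_excursionSeries, walkSum_zero,
    if_pos rfl]

theorem coeff_stepPoly_zero (hmin : IsLeast (S : Set ℤ) (-(b : ℤ))) :
    (stepPoly S ω b).coeff 0 = ω (-(b : ℤ)) := by
  rw [stepPoly, Polynomial.finsetSum_coeff, Finset.sum_eq_single (-(b : ℤ))]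
  · simp
  · intro s hs hne
    have : -(b : ℤ) ≤ s := hmin.2 hs
    rw [Polynomial.coeff_C_mul, Polynomial.coeff_X_pow, if_neg (by omega), mul_zero]
  · exact fun h => absurd hmin.1 h

theorem coeff_stepPoly_top {a : ℕ} (hmax : IsGreatest (S : Set ℤ) (a : ℤ))
    (hS : ∀ s ∈ S, -(b : ℤ) ≤ s) : (stepPoly S ω b).coeff (a + b) = ω a := by
  rw [stepPoly, Polynomial.finsetSum_coeff, Finset.sum_eq_single (a : ℤ)]
  · rw [Polynomial.coeff_C_mul, Polynomial.coeff_X_pow, if_pos (by omega), mul_one]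
  · intro s hs hne
    have h1 : s ≤ a := hmax.2 hs
    have h2 := hS s hs
    rw [Polynomial.coeff_C_mul, Polynomial.coeff_X_pow, if_neg (by omega), mul_zero]
  · exact fun h => absurd hmax.1 h

theorem natDegree_stepPoly {a : ℕ} (hmax : IsGreatest (S : Set ℤ) (a : ℤ))
    (hS : ∀ s ∈ S, -(b : ℤ) ≤ s) (hωa : ω a ≠ 0) : (stepPoly S ω b).natDegree = a + b := by
  refine le_antisymm ?_ (Polynomial.le_natDegree_of_ne_zero ?_)
  · refine Polynomial.natDegree_sum_le_of_forall_le _ _ fun s hs => ?_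
    refine (Polynomial.natDegree_C_mul_X_pow_le _ _).trans ?_
    have h1 : s ≤ a := hmax.2 hs
    have h2 := hS s hs
    omega
  · rwa [coeff_stepPoly_top ω hmax hS]

/-- Exponent 0 in R_n stands for the position -b, reached from a non-negative position only by the
step -b taken at 0, that is, after an excursion. -/
theorem coeff_walkRem_zero (hmin : IsLeast (S : Set ℤ) (-(b : ℤ))) (hb : 0 < b) (n : ℕ) :
    (walkRem S ω b n).coeff 0 =
      ω (-(b : ℤ)) * PowerSeries.coeff n (excursionSeries S ω) := by
  rw [coeff_walkRem S ω b hb, Polynomial.mul_coeff_zero, coeff_stepPoly_zero ω hmin,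
    coeff_excursionSeries_eq_walkPoly ω fun s hs => hmin.2 hs]

/-- The telescoped kernel equation for the walks of length less than `M`, in which the two
variables take the values `t` and `u` in a commutative ring. -/
theorem kernel_equation {R : Type*} [CommRing R] (φ : K →+* R) (t u : R)
    (hu : u ^ b = t * (stepPoly S ω b).eval₂ φ u) (M : ℕ) :
    u ^ b - ∑ n ∈ range M, t ^ (n + 1) * (walkRem S ω b n).eval₂ φ u =
      t ^ M * (u ^ b * (walkPoly S ω b M).eval₂ φ u) := by
  induction M with
  | zero => simp [walkPoly]
  | succ M ih =>
    have h := congrArg (Polynomial.eval₂ φ u) (walkRem_add_walkPoly_succ S ω b M)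
    rw [Polynomial.eval₂_add, Polynomial.eval₂_mul, Polynomial.eval₂_mul, Polynomial.eval₂_X_pow]
      at h
    rw [Finset.sum_range_succ, ← sub_sub, ih]
    linear_combination t ^ M * (walkPoly S ω b M).eval₂ φ u * hu - t ^ (M + 1) * h

end Walks

/-! ### Roots of `v ^ b = Q (s v)` in power series -/

section Hensel

open Polynomial in
/-- Hensel's lemma for the equation `v ^ b = Q (s * v)` over the power series in `s`. -/
theorem exists_powerSeries_pow_eq {L : Type*} [Field L] [CharZero L] (Q : L[X]) {b : ℕ}
    (hb : 0 < b) (hbd : b ≤ Q.natDegree) (hQ : Q.coeff 0 ≠ 0) (β : L) (hβ : β ^ b = Q.coeff 0) :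
    ∃ v : L⟦X⟧, v ^ b = Q.eval₂ PowerSeries.C (PowerSeries.X * v) ∧
      PowerSeries.constantCoeff v = β := by
  set d := Q.natDegree with hd
  have hβ0 : β ≠ 0 := by
    rintro rfl
    rw [zero_pow hb.ne'] at hβ
    exact hQ hβ.symm
  -- Hensel's lemma needs a monic polynomial, but the leading coefficient of Q(s v) in v is not a
  -- unit. Passing to w = 1/v, multiplying by w^d and dividing by Q(0) gives the monic equation w^d
  -- + r(w) = 0.
  let r : L⟦X⟧[X] := ∑ k ∈ Finset.range d,
      C (PowerSeries.C (Q.coeff (k + 1) / Q.coeff 0) * PowerSeries.X ^ (k + 1)) *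
        X ^ (d - (k + 1)) - C (PowerSeries.C (Q.coeff 0)⁻¹) * X ^ (d - b)
  have hr : r.degree < d := by
    refine (degree_sub_le _ _).trans_lt (max_lt ?_ ?_)
    · refine (degree_sum_le _ _).trans_lt ((Finset.sup_lt_iff (WithBot.bot_lt_coe d)).2 ?_)
      intro k hk
      refine (degree_C_mul_X_pow_le _ _).trans_lt ?_
      have := Finset.mem_range.1 hk
      have hlt : d - (k + 1) < d := by omega
      exact Nat.cast_lt.2 hlt
    · refine (degree_C_mul_X_pow_le _ _).trans_lt ?_
      have hlt : d - b < d := by omega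
      exact Nat.cast_lt.2 hlt
  let f : L⟦X⟧[X] := X ^ d + r
  have hf : f.Monic := monic_X_pow_add hr
  have hmap : f.map (PowerSeries.constantCoeff (R := L)) =
      X ^ d - C (Q.coeff 0)⁻¹ * X ^ (d - b) := by
    simp [f, r, Polynomial.map_sum, sub_eq_add_neg]
  have hdb : β⁻¹ ^ d = β⁻¹ ^ b * β⁻¹ ^ (d - b) := by rw [← pow_add]; congr 1; omega
  have hβb : β⁻¹ ^ b = (Q.coeff 0)⁻¹ := by rw [inv_pow, hβ]
  have h0 : (f.map (PowerSeries.constantCoeff (R := L))).eval β⁻¹ = 0 := by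
    rw [hmap]
    simp [-inv_pow, hdb, hβb]
  -- The root is simple: at s = 0 and w = 1/β, w times the derivative is d w^d - (d - b) w^d = b
  -- w^d, nonzero in characteristic 0.
  have h1 : (f.map (PowerSeries.constantCoeff (R := L))).derivative.eval β⁻¹ ≠ 0 := by
    rw [hmap]
    have : β⁻¹ * (derivative (X ^ d - C (Q.coeff 0)⁻¹ * X ^ (d - b))).eval β⁻¹ =
        b * β⁻¹ ^ d := by
      have key : ∀ n : ℕ, β⁻¹ * ((n : L) * β⁻¹ ^ (n - 1)) = n * β⁻¹ ^ n := by
        intro n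
        cases n with
        | zero => simp
        | succ n => rw [Nat.add_sub_cancel, pow_succ]; ring
      simp only [derivative_sub, derivative_X_pow, derivative_C_mul_X_pow, eval_sub, eval_mul,
        eval_C, eval_pow, eval_X, mul_sub]
      rw [key, mul_assoc, mul_left_comm, key, Nat.cast_sub hbd, mul_left_comm, ← hβb, ← hdb]
      ring
    intro h
    rw [h, mul_zero] at this
    exact mul_ne_zero (Nat.cast_ne_zero.2 hb.ne') (pow_ne_zero _ (inv_ne_zero hβ0)) this.symm
  obtain ⟨w, hw, hw'⟩ := HenselianRing.is_henselian (I := Ideal.span {(PowerSeries.X : L⟦X⟧)}) f hf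
    (PowerSeries.C β⁻¹) (by
      rw [Ideal.mem_span_singleton, PowerSeries.X_dvd_iff, ← eval_map_apply]
      simpa using h0) (by
      refine IsUnit.map _ ?_
      rw [PowerSeries.isUnit_iff_constantCoeff, ← eval_map_apply, ← derivative_map]
      simpa using h1)
  rw [Ideal.mem_span_singleton, PowerSeries.X_dvd_iff, map_sub, sub_eq_zero,
    PowerSeries.constantCoeff_C] at hw'
  have hwv : w * w⁻¹ = 1 := PowerSeries.mul_inv_cancel _ (by rw [hw']; exact inv_ne_zero hβ0)
  refine ⟨w⁻¹, ?_, by rw [PowerSeries.constantCoeff_inv, hw', inv_inv]⟩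
  have hpow : ∀ k ≤ d, w ^ (d - k) * w⁻¹ ^ d = w⁻¹ ^ k := by
    intro k hk
    conv_lhs => rw [← Nat.sub_add_cancel hk, Nat.add_sub_cancel, pow_add, ← mul_assoc, ← mul_pow,
      hwv, one_pow, one_mul]
  have hQQ : PowerSeries.C (Q.coeff 0) * PowerSeries.C (Q.coeff 0)⁻¹ = (1 : L⟦X⟧) := by
    rw [← map_mul, mul_inv_cancel₀ hQ, map_one]
  have hsum : PowerSeries.C (Q.coeff 0) * ((∑ k ∈ Finset.range d, PowerSeries.C (Q.coeff (k + 1) /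
      Q.coeff 0) * PowerSeries.X ^ (k + 1) * w ^ (d - (k + 1))) * w⁻¹ ^ d) =
      ∑ k ∈ Finset.range d, PowerSeries.C (Q.coeff (k + 1)) * (PowerSeries.X * w⁻¹) ^ (k + 1) := by
    rw [Finset.sum_mul, Finset.mul_sum]
    refine Finset.sum_congr rfl fun k hk => ?_
    rw [mul_assoc, hpow (k + 1) (Finset.mem_range.1 hk), div_eq_mul_inv, map_mul, mul_pow]
    linear_combination PowerSeries.C (Q.coeff (k + 1)) * PowerSeries.X ^ (k + 1) *
      w⁻¹ ^ (k + 1) * hQQ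
  have hw2 := hw.eq_zero
  simp only [f, r, eval_add, eval_sub, eval_mul, eval_pow, eval_X, eval_C, eval_finsetSum] at hw2
  have h2 : w ^ d * w⁻¹ ^ d = 1 := by rw [← mul_pow, hwv, one_pow]
  rw [eval₂_eq_sum_range, ← hd, Finset.sum_range_succ', ← hsum]
  linear_combination PowerSeries.C (Q.coeff 0) * h2 - w⁻¹ ^ b * hQQ -
    PowerSeries.C (Q.coeff 0) * PowerSeries.C (Q.coeff 0)⁻¹ * hpow b hbd -
    PowerSeries.C (Q.coeff 0) * w⁻¹ ^ d * hw2

end Hensel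

/-! ### Puiseux series that are finite at zero -/

section Puiseux

variable {K L : Type*} [Field K] [Field L] [Algebra K L]

theorem finiteAtZero_iff {f : PuiseuxSeries L} :
    FiniteAtZero f ↔ 0 ≤ (f : HahnSeries ℚ L).orderTop := by
  rw [HahnSeries.le_orderTop_iff_forall]
  simp only [FiniteAtZero, ← WithTop.coe_zero, WithTop.coe_lt_coe]

variable (L) in
/-- The subring of the Puiseux series that are finite at `t = 0`. -/
def finiteSubring : Subring (PuiseuxSeries L) where
  carrier := {f | FiniteAtZero f}
  zero_mem' _ _ := rfl
  one_mem' := finiteAtZero_iff.2 (by simp)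
  add_mem' := by
    intro f g hf hg q hq
    simp [hf q hq, hg q hq]
  mul_mem' := by
    intro f g hf hg
    refine finiteAtZero_iff.2 ?_
    simpa using add_nonneg (finiteAtZero_iff.1 hf) (finiteAtZero_iff.1 hg)
  neg_mem' := by
    intro f hf q hq
    simp [hf q hq]

theorem mem_finiteSubring {f : PuiseuxSeries L} : f ∈ finiteSubring L ↔ FiniteAtZero f := Iff.rfl

/-- The finite series form a valuation ring: the orders of f and 1/f add up to 0. -/
theorem inv_mem_finiteSubring {f : PuiseuxSeries L} (hf : f ∉ finiteSubring L) :
    f⁻¹ ∈ finiteSubring L := by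
  have h0 : f ≠ 0 := by
    rintro rfl
    exact hf (zero_mem _)
  rw [mem_finiteSubring, finiteAtZero_iff] at *
  have h1 := congrArg (fun g : PuiseuxSeries L => (g : HahnSeries ℚ L).orderTop)
    (mul_inv_cancel₀ h0)
  simp only [Subfield.coe_mul, HahnSeries.orderTop_mul, Subfield.coe_one,
    HahnSeries.orderTop_one] at h1
  revert h1 hf
  generalize (f : HahnSeries ℚ L).orderTop = x
  generalize ((f⁻¹ : PuiseuxSeries L) : HahnSeries ℚ L).orderTop = y
  intro hf h1
  cases x with
  | top => exact absurd le_top hf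
  | coe x =>
    cases y with
    | top => exact le_top
    | coe y =>
      norm_cast at *
      linarith

theorem coe_toPuiseux (f : K⟦X⟧) : (toPuiseux K L f : HahnSeries ℚ L) =
    HahnSeries.ofPowerSeries ℚ L (f.map (algebraMap K L)) := rfl

theorem coe_toPuiseux_X : (toPuiseux K L PowerSeries.X : HahnSeries ℚ L) =
    HahnSeries.single 1 1 := by
  rw [coe_toPuiseux, PowerSeries.map_X, HahnSeries.ofPowerSeries_X]

theorem toPuiseux_injective : Function.Injective (toPuiseux K L) := fun _ _ h =>
  PowerSeries.map_injective (algebraMap K L) (algebraMap K L).injective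
    (HahnSeries.ofPowerSeries_injective (congrArg Subtype.val h))

theorem polyToPuiseux_injective : Function.Injective (polyToPuiseux K L) :=
  toPuiseux_injective.comp (Polynomial.coe_injective K)

theorem polyToPuiseux_apply (p : K[X]) : polyToPuiseux K L p = toPuiseux K L (p : K⟦X⟧) := rfl

theorem coeff_toPuiseux (f : K⟦X⟧) (n : ℕ) :
    (toPuiseux K L f : HahnSeries ℚ L).coeff n = algebraMap K L (PowerSeries.coeff n f) := by
  rw [coe_toPuiseux, HahnSeries.ofPowerSeries_apply_coeff, PowerSeries.coeff_map]

theorem toPuiseux_mem (f : K⟦X⟧) : toPuiseux K L f ∈ finiteSubring L := by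
  intro q hq
  rw [coe_toPuiseux, HahnSeries.ofPowerSeries_apply]
  refine HahnSeries.embDomain_of_notMem_range ?_
  rintro ⟨k, rfl⟩
  exact absurd hq (by simp)

theorem toPuiseux_X_ne_zero : toPuiseux K L PowerSeries.X ≠ 0 := by
  rw [Ne, map_eq_zero_iff _ toPuiseux_injective]
  exact PowerSeries.X_ne_zero

theorem coeff_toPuiseux_X_pow_mul (M : ℕ) (f : PuiseuxSeries L) (q : ℚ) :
    ((toPuiseux K L PowerSeries.X ^ M * f : PuiseuxSeries L) : HahnSeries ℚ L).coeff q =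
      (f : HahnSeries ℚ L).coeff (q - M) := by
  rw [Subfield.coe_mul, SubmonoidClass.coe_pow, coe_toPuiseux_X, HahnSeries.single_pow]
  simp [HahnSeries.coeff_single_mul]

theorem toPuiseux_X_inv_notMem : (toPuiseux K L PowerSeries.X)⁻¹ ∉ finiteSubring L := by
  intro h
  have h1 := h (-1) (by norm_num)
  have h2 := coeff_toPuiseux_X_pow_mul (K := K) 1 (toPuiseux K L PowerSeries.X)⁻¹ 0
  rw [pow_one, mul_inv_cancel₀ toPuiseux_X_ne_zero] at h2
  rw [show (0 : ℚ) - (1 : ℕ) = -1 by norm_num, h1] at h2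
  simp at h2

/-- t-adic separatedness; it replaces the passage to the limit in the kernel method. -/
theorem eq_zero_of_forall_pow_mul {f : PuiseuxSeries L}
    (hf : ∀ M : ℕ, ∃ g ∈ finiteSubring L, f = toPuiseux K L PowerSeries.X ^ M * g) : f = 0 := by
  refine Subtype.ext (HahnSeries.ext (funext fun q => ?_))
  obtain ⟨M, hM⟩ := exists_nat_gt q
  obtain ⟨g, hg, rfl⟩ := hf M
  rw [coeff_toPuiseux_X_pow_mul]
  exact hg _ (by linarith)

/-- A Puiseux series that is finite at zero and is a Laurent polynomial is a polynomial. -/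
theorem mem_range_polyToPuiseux {f : PuiseuxSeries L} (hf : f ∈ finiteSubring L) {M : ℕ} {p : K[X]}
    (hp : toPuiseux K L PowerSeries.X ^ M * f = polyToPuiseux K L p) :
    f ∈ (polyToPuiseux K L).range := by
  have hX : polyToPuiseux K L Polynomial.X = toPuiseux K L PowerSeries.X :=
    congrArg (toPuiseux K L) Polynomial.coe_X
  -- For d < M, the coefficient of t^d in p is that of t^(d - M) in f, a negative power.
  obtain ⟨r, rfl⟩ : Polynomial.X ^ M ∣ p := by
    rw [Polynomial.X_pow_dvd_iff]
    intro d hd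
    have h := congrArg (fun g : PuiseuxSeries L => (g : HahnSeries ℚ L).coeff d) hp
    simp only [coeff_toPuiseux_X_pow_mul] at h
    rw [hf _ (by simpa using hd)] at h
    have h2 := coeff_toPuiseux (K := K) (L := L) (p : K⟦X⟧) d
    rw [Polynomial.coeff_coe, ← polyToPuiseux_apply, ← h] at h2
    exact (map_eq_zero (algebraMap K L)).1 h2.symm
  refine ⟨r, ?_⟩
  rw [map_mul, map_pow, hX] at hp
  exact (mul_left_cancel₀ (pow_ne_zero M toPuiseux_X_ne_zero) hp).symm

variable (K L) in
/-- The embedding of the constants into the Puiseux series. -/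
def constToPuiseux : K →+* PuiseuxSeries L := (toPuiseux K L).comp PowerSeries.C

theorem toPuiseux_C (x : K) : toPuiseux K L (PowerSeries.C x) = constToPuiseux K L x := rfl

theorem constToPuiseux_mem (x : K) : constToPuiseux K L x ∈ finiteSubring L := toPuiseux_mem _

theorem constToPuiseux_algebraMap (x : K) :
    constToPuiseux L L (algebraMap K L x) = constToPuiseux K L x := by
  refine Subtype.ext ?_
  simp [constToPuiseux, coe_toPuiseux]

theorem constToPuiseux_comp_algebraMap :
    (constToPuiseux L L).comp (algebraMap K L) = constToPuiseux K L := by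
  ext1 x
  rw [RingHom.comp_apply, constToPuiseux_algebraMap]

theorem toPuiseux_X_eq : toPuiseux L L PowerSeries.X = toPuiseux K L PowerSeries.X :=
  Subtype.ext (by rw [coe_toPuiseux_X, coe_toPuiseux_X])

theorem eval₂_mem_finiteSubring (p : K[X]) {u : PuiseuxSeries L} (hu : u ∈ finiteSubring L) :
    p.eval₂ (constToPuiseux K L) u ∈ finiteSubring L := by
  rw [Polynomial.eval₂_eq_sum_range]
  exact sum_mem fun i _ => mul_mem (constToPuiseux_mem _) (pow_mem hu _)

variable (L) in
/-- The embedding of power series into Puiseux series that sends the variable to `t^{1/n}`. -/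
def ramifyPowerSeries {n : ℕ} (hn : 0 < n) : L⟦X⟧ →+* PuiseuxSeries L :=
  ((ramify L hn).comp (HahnSeries.ofPowerSeries ℤ L)).codRestrict (puiseuxField L)
    fun f => (isPuiseux_iff _).2 ⟨n, hn, HahnSeries.ofPowerSeries ℤ L f, rfl⟩

theorem ramifyPowerSeries_injective {n : ℕ} (hn : 0 < n) :
    Function.Injective (ramifyPowerSeries L hn) := fun _ _ h =>
  HahnSeries.ofPowerSeries_injective
    (HahnSeries.embDomain_injective (congrArg Subtype.val h))

theorem coe_ramifyPowerSeries {n : ℕ} (hn : 0 < n) (f : L⟦X⟧) :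
    (ramifyPowerSeries L hn f : HahnSeries ℚ L) =
      HahnSeries.embDomain ⟨⟨divHom n, divHom_injective hn⟩, divHom_le_iff hn _ _⟩
        (HahnSeries.ofPowerSeries ℤ L f) := rfl

theorem ramifyPowerSeries_mem {n : ℕ} (hn : 0 < n) (f : L⟦X⟧) :
    ramifyPowerSeries L hn f ∈ finiteSubring L := by
  intro q hq
  rw [coe_ramifyPowerSeries]
  by_cases h : ∃ k : ℤ, divHom n k = q
  · obtain ⟨k, rfl⟩ := h
    refine (HahnSeries.embDomain_coeff
      (f := ⟨⟨divHom n, divHom_injective hn⟩, divHom_le_iff hn _ _⟩) (a := k)).trans ?_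
    have hk : k < 0 := by
      by_contra hk
      exact hq.not_ge (by simpa using (divHom_le_iff hn 0 k).2 (not_lt.1 hk))
    rw [HahnSeries.ofPowerSeries_apply]
    refine HahnSeries.embDomain_of_notMem_range ?_
    rintro ⟨m, rfl⟩
    exact absurd hk (by simp)
  · refine HahnSeries.embDomain_of_notMem_range ?_
    rintro ⟨k, hk⟩
    exact h ⟨k, hk⟩

theorem ramifyPowerSeries_C {n : ℕ} (hn : 0 < n) (x : L) :
    ramifyPowerSeries L hn (PowerSeries.C x) = constToPuiseux L L x := by
  refine Subtype.ext ?_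
  rw [coe_ramifyPowerSeries, constToPuiseux, RingHom.comp_apply, coe_toPuiseux]
  simp only [Algebra.algebraMap_self, PowerSeries.map_id,
    HahnSeries.ofPowerSeries_C, HahnSeries.C_apply, id]
  exact HahnSeries.embDomain_single.trans <| congrArg (fun q => HahnSeries.single q x) (map_zero (divHom n))

theorem ramifyPowerSeries_X_pow {n : ℕ} (hn : 0 < n) :
    ramifyPowerSeries L hn PowerSeries.X ^ n = toPuiseux L L PowerSeries.X := by
  refine Subtype.ext ?_
  rw [SubmonoidClass.coe_pow, coe_ramifyPowerSeries, coe_toPuiseux_X, HahnSeries.ofPowerSeries_X,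
    HahnSeries.embDomain_single, HahnSeries.single_pow, one_pow]
  have : (n : ℚ) ≠ 0 := by exact_mod_cast hn.ne'
  have h : n • divHom n 1 = 1 := by
    change n • ((1 : ℤ) / n : ℚ) = 1
    rw [nsmul_eq_mul]
    field_simp
    simp
  exact congrArg (fun q => HahnSeries.single q (1 : L)) h

/-- Solutions of `u ^ b = t Q(u)` that are finite at zero vanish at zero. -/
theorem inv_notMem_finiteSubring {Q : L[X]} {b : ℕ} {u : PuiseuxSeries L}
    (hu : u ∈ finiteSubring L) (hu0 : u ≠ 0)
    (h : u ^ b = toPuiseux L L PowerSeries.X * Q.eval₂ (constToPuiseux L L) u) :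
    u⁻¹ ∉ finiteSubring L := by
  intro hi
  refine toPuiseux_X_inv_notMem (K := L) (L := L) ?_
  -- If u and 1/u were both finite, the equation would make 1/t finite.
  have : (toPuiseux L L PowerSeries.X)⁻¹ = Q.eval₂ (constToPuiseux L L) u * u⁻¹ ^ b := by
    rw [inv_eq_iff_eq_inv, inv_pow, h]
    have h0 : Q.eval₂ (constToPuiseux L L) u ≠ 0 := by
      intro h0
      rw [h0, mul_zero] at h
      exact pow_ne_zero _ hu0 h
    field_simp
  rw [this]
  exact mul_mem (eval₂_mem_finiteSubring Q hu) (pow_mem hi _)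

end Puiseux

/-! ### Roots of `u ^ b = t Q(u)` -/

section Roots

variable {L : Type*} [Field L] [CharZero L] [IsAlgClosed L]

theorem exists_injective_pow_eq {b : ℕ} (hb : 0 < b) {x : L} (hx : x ≠ 0) :
    ∃ β : Fin b → L, Function.Injective β ∧ ∀ i, β i ^ b = x := by
  have : NeZero b := ⟨hb.ne'⟩
  obtain ⟨β, hβ⟩ := IsAlgClosed.exists_pow_nat_eq x hb
  have hζ := HasEnoughRootsOfUnity.exists_primitiveRoot L b
  obtain ⟨ζ, hζ⟩ := hζ
  have hβ0 : β ≠ 0 := by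
    rintro rfl
    rw [zero_pow hb.ne'] at hβ
    exact hx hβ.symm
  refine ⟨fun i => ζ ^ (i : ℕ) * β, fun i j hij => ?_, fun i => ?_⟩
  · exact Fin.ext (hζ.pow_inj i.2 j.2 (mul_right_cancel₀ hβ0 hij))
  · rw [mul_pow, ← pow_mul, mul_comm (i : ℕ), pow_mul, hζ.pow_eq_one, one_pow, one_mul, hβ]

/-- The equation `u ^ b = t Q(u)` has `b` distinct solutions that are finite at zero. -/
theorem exists_finite_roots (Q : L[X]) {b : ℕ} (hb : 0 < b) (hbd : b ≤ Q.natDegree)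
    (hQ : Q.coeff 0 ≠ 0) :
    ∃ W : Fin b → PuiseuxSeries L, Function.Injective W ∧ ∀ i, W i ∈ finiteSubring L ∧ W i ≠ 0 ∧
      W i ^ b = toPuiseux L L PowerSeries.X * Q.eval₂ (constToPuiseux L L) (W i) := by
  obtain ⟨β, hβ, hβb⟩ := exists_injective_pow_eq hb hQ
  -- The roots are s v with s = t^{1/b}; the distinct constant terms β of the series v keep them
  -- apart.
  choose v hv hvβ using fun i => exists_powerSeries_pow_eq Q hb hbd hQ (β i) (hβb i)
  refine ⟨fun i => ramifyPowerSeries L hb (PowerSeries.X * v i), fun i j hij => ?_, fun i =>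
    ⟨ramifyPowerSeries_mem _ _, ?_, ?_⟩⟩
  · have h := mul_left_cancel₀ PowerSeries.X_ne_zero (ramifyPowerSeries_injective hb hij)
    exact hβ (by rw [← hvβ i, ← hvβ j, h])
  · rw [Ne, map_eq_zero_iff _ (ramifyPowerSeries_injective hb), mul_eq_zero, not_or]
    refine ⟨PowerSeries.X_ne_zero, fun h => hQ ?_⟩
    rw [← hβb i, ← hvβ i, h, map_zero, zero_pow hb.ne']
  · have hc : (ramifyPowerSeries L hb).comp PowerSeries.C = constToPuiseux L L :=
      RingHom.ext (ramifyPowerSeries_C hb)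
    beta_reduce
    rw [map_mul, mul_pow, ramifyPowerSeries_X_pow, ← map_pow, hv i, Polynomial.hom_eval₂, hc, map_mul]

/-- The equation `u ^ b = t Q(u)`, where `Q` has degree `a + b`, has `a` distinct solutions that
are infinite at zero. -/
theorem exists_infinite_roots (Q : L[X]) {a b : ℕ} (ha : 0 < a) (hd : Q.natDegree = a + b)
    (hQ : Q.coeff 0 ≠ 0) :
    ∃ V : Fin a → PuiseuxSeries L, Function.Injective V ∧ ∀ i, V i ∉ finiteSubring L ∧
      V i ^ b = toPuiseux L L PowerSeries.X * Q.eval₂ (constToPuiseux L L) (V i) := by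
  have hQ0 : Q ≠ 0 := by
    rintro rfl
    exact hQ rfl
  -- With w = 1/u and deg Q = a + b, the equation u^b = t Q(u) becomes w^a = t Q.reverse(w).
  obtain ⟨W, hW, h⟩ := exists_finite_roots Q.reverse ha
    (by
      rw [Polynomial.reverse_natDegree, Polynomial.natTrailingDegree_eq_zero.2 (.inr hQ)]
      omega)
    (by rwa [Polynomial.coeff_zero_reverse, Polynomial.leadingCoeff_ne_zero])
  refine ⟨fun i => (W i)⁻¹, inv_injective.comp hW, fun i => ?_⟩
  obtain ⟨h1, h2, h3⟩ := h i
  refine ⟨inv_notMem_finiteSubring h1 h2 h3, ?_⟩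
  have : Invertible (W i)⁻¹ := invertibleOfNonzero (inv_ne_zero h2)
  have h4 := Polynomial.eval₂_reverse_mul_pow (constToPuiseux L L) (W i)⁻¹ Q
  rw [invOf_eq_inv, inv_inv, hd] at h4
  rw [← h4, ← mul_assoc, ← h3, pow_add, ← mul_assoc, ← mul_pow, mul_inv_cancel₀ h2, one_pow, one_mul]

end Roots

/-! ### The roots of the kernel -/

section Kernel

open Finset

variable {K L : Type*} [Field K] [Field L] [Algebra K L] {S : Finset ℤ} {ω : ℤ → K} {a b : ℕ}

theorem polyToPuiseux_C (x : K) :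
    polyToPuiseux K L (Polynomial.C x) = constToPuiseux K L x :=
  congrArg (toPuiseux K L) (Polynomial.coe_C x)

theorem polyToPuiseux_X : polyToPuiseux K L Polynomial.X = toPuiseux K L PowerSeries.X :=
  congrArg (toPuiseux K L) Polynomial.coe_X

theorem map_kernel : (kernel S ω b).map (polyToPuiseux K L) =
    Polynomial.X ^ b - Polynomial.C (toPuiseux K L PowerSeries.X) *
      (stepPoly S ω b).map (constToPuiseux K L) := by
  simp [kernel, stepPoly, Polynomial.map_sum, polyToPuiseux_C, polyToPuiseux_X]

theorem isRoot_kernel_iff {u : PuiseuxSeries L} :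
    ((kernel S ω b).map (polyToPuiseux K L)).IsRoot u ↔
      u ^ b = toPuiseux K L PowerSeries.X * (stepPoly S ω b).eval₂ (constToPuiseux K L) u := by
  rw [map_kernel, Polynomial.IsRoot, Polynomial.eval_sub, sub_eq_zero, Polynomial.eval_mul,
    Polynomial.eval_pow, Polynomial.eval_X, Polynomial.eval_C, Polynomial.eval_map]

theorem natDegree_map_kernel (ha : 0 < a) (hmax : IsGreatest (S : Set ℤ) (a : ℤ))
    (hmin : IsLeast (S : Set ℤ) (-(b : ℤ))) (hωa : ω a ≠ 0) :
    ((kernel S ω b).map (polyToPuiseux K L)).natDegree = a + b := by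
  have h : (Polynomial.C (toPuiseux K L PowerSeries.X) *
      (stepPoly S ω b).map (constToPuiseux K L)).natDegree = a + b := by
    rw [Polynomial.natDegree_C_mul toPuiseux_X_ne_zero, Polynomial.natDegree_map,
      natDegree_stepPoly ω hmax (fun s hs => hmin.2 hs) hωa]
  rw [map_kernel, Polynomial.natDegree_sub_eq_right_of_natDegree_lt, h]
  rw [h, Polynomial.natDegree_X_pow]
  omega

theorem leadingCoeff_map_kernel (ha : 0 < a) (hmax : IsGreatest (S : Set ℤ) (a : ℤ))
    (hmin : IsLeast (S : Set ℤ) (-(b : ℤ))) (hωa : ω a ≠ 0) :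
    ((kernel S ω b).map (polyToPuiseux K L)).leadingCoeff =
      -(toPuiseux K L PowerSeries.X * constToPuiseux K L (ω a)) := by
  rw [Polynomial.leadingCoeff, natDegree_map_kernel ha hmax hmin hωa, map_kernel,
    Polynomial.coeff_sub, Polynomial.coeff_X_pow, if_neg (by omega), Polynomial.coeff_C_mul,
    Polynomial.coeff_map, coeff_stepPoly_top ω hmax fun s hs => hmin.2 hs, zero_sub]

theorem coeff_map_kernel_zero (hb : 0 < b) (hmin : IsLeast (S : Set ℤ) (-(b : ℤ))) :
    ((kernel S ω b).map (polyToPuiseux K L)).coeff 0 =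
      -(toPuiseux K L PowerSeries.X * constToPuiseux K L (ω (-(b : ℤ)))) := by
  rw [map_kernel, Polynomial.coeff_sub, Polynomial.coeff_X_pow, if_neg hb.ne,
    Polynomial.coeff_C_mul, Polynomial.coeff_map, coeff_stepPoly_zero ω hmin, zero_sub]

theorem map_kernel_ne_zero (ha : 0 < a) (hmax : IsGreatest (S : Set ℤ) (a : ℤ))
    (hmin : IsLeast (S : Set ℤ) (-(b : ℤ))) (hωa : ω a ≠ 0) :
    (kernel S ω b).map (polyToPuiseux K L) ≠ 0 := by
  intro h
  have := natDegree_map_kernel (L := L) ha hmax hmin hωa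
  rw [h, Polynomial.natDegree_zero] at this
  omega

/-- The b finite and a infinite solutions are pairwise distinct and as many as the degree of the
kernel, so they are all its roots, each of multiplicity one. -/
theorem exists_injective_isRootLabelling [CharZero L] [IsAlgClosed L] (ha : 0 < a) (hb : 0 < b)
    (hmax : IsGreatest (S : Set ℤ) (a : ℤ)) (hmin : IsLeast (S : Set ℤ) (-(b : ℤ)))
    (hωa : ω a ≠ 0) (hωb : ω (-(b : ℤ)) ≠ 0) :
    ∃ U : Fin (a + b) → PuiseuxSeries L, IsRootLabelling S ω a b U ∧ Function.Injective U := by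
  have hroot : ∀ u : PuiseuxSeries L, u ^ b = toPuiseux L L PowerSeries.X *
      ((stepPoly S ω b).map (algebraMap K L)).eval₂ (constToPuiseux L L) u →
      ((kernel S ω b).map (polyToPuiseux K L)).IsRoot u := by
    intro u hu
    rw [isRoot_kernel_iff, hu, Polynomial.eval₂_map, constToPuiseux_comp_algebraMap, toPuiseux_X_eq (K := K)]
  have hd : ((stepPoly S ω b).map (algebraMap K L)).natDegree = a + b := by
    rw [Polynomial.natDegree_map, natDegree_stepPoly ω hmax (fun s hs => hmin.2 hs) hωa]
  have h0 : ((stepPoly S ω b).map (algebraMap K L)).coeff 0 ≠ 0 := by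
    rwa [Polynomial.coeff_map, coeff_stepPoly_zero ω hmin, Ne, map_eq_zero]
  obtain ⟨W, hW, hW'⟩ := exists_finite_roots _ hb (by omega) h0
  obtain ⟨V, hV, hV'⟩ := exists_infinite_roots _ ha hd h0
  let U : Fin (a + b) → PuiseuxSeries L := fun i =>
    if h : (i : ℕ) < b then W ⟨i, h⟩ else V ⟨i - b, by omega⟩
  have hsmall : ∀ i : Fin (a + b), (i : ℕ) < b → U i ∈ finiteSubring L := by
    intro i hi
    simp only [U, dif_pos hi]
    exact (hW' _).1
  have hlarge : ∀ i : Fin (a + b), b ≤ (i : ℕ) → U i ∉ finiteSubring L := by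
    intro i hi
    simp only [U, dif_neg hi.not_gt]
    exact (hV' _).1
  have hU : Function.Injective U := by
    intro i j hij
    by_cases hi : (i : ℕ) < b <;> by_cases hj : (j : ℕ) < b
    · simp only [U, dif_pos hi, dif_pos hj] at hij
      exact Fin.ext (by simpa using hW hij)
    · exact absurd (hij ▸ hsmall i hi) (hlarge j (not_lt.1 hj))
    · exact absurd (hij ▸ hsmall j hj) (hlarge i (not_lt.1 hi))
    · simp only [U, dif_neg hi, dif_neg hj] at hij
      have := congrArg Fin.val (hV hij)
      simp only at this
      omega
  refine ⟨U, ⟨?_, hsmall, hlarge⟩, hU⟩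
  refine (Multiset.eq_of_le_of_card_le ((Multiset.le_iff_subset
    (Finset.univ.nodup.map hU)).2 fun u hu => ?_) ?_).symm
  · obtain ⟨i, -, rfl⟩ := Multiset.mem_map.1 hu
    refine (Polynomial.mem_roots (map_kernel_ne_zero ha hmax hmin hωa)).2 (hroot _ ?_)
    by_cases hi : (i : ℕ) < b
    · simp only [U, dif_pos hi]
      exact (hW' _).2.2
    · simp only [U, dif_neg hi]
      exact (hV' _).2
  · refine (Polynomial.card_roots' _).trans ?_
    rw [natDegree_map_kernel ha hmax hmin hωa]
    simp

variable (S ω b) in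
/-- The monic polynomial in `u` of degree `b` that is the product of the kernel and of the
generating series of the walks on the non-negative integers. -/
def smallFactor : K⟦X⟧[X] :=
  Polynomial.X ^ b - ∑ j ∈ range b, Polynomial.C
    (PowerSeries.X * PowerSeries.mk fun n => (walkRem S ω b n).coeff j) * Polynomial.X ^ j

theorem degree_smallFactor_aux : (∑ j ∈ range b, Polynomial.C (PowerSeries.X *
    PowerSeries.mk fun n => (walkRem S ω b n).coeff j) * Polynomial.X ^ j).degree < (b : WithBot ℕ) := by
  refine (Polynomial.degree_sum_le _ _).trans_lt ((Finset.sup_lt_iff (WithBot.bot_lt_coe b)).2 ?_)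
  intro j hj
  exact (Polynomial.degree_C_mul_X_pow_le _ _).trans_lt (Nat.cast_lt.2 (Finset.mem_range.1 hj))

theorem monic_smallFactor : (smallFactor S ω b).Monic :=
  Polynomial.monic_X_pow_sub degree_smallFactor_aux

theorem degree_smallFactor : (smallFactor S ω b).degree = b := by
  rw [smallFactor, Polynomial.degree_sub_eq_left_of_degree_lt, Polynomial.degree_X_pow]
  rw [Polynomial.degree_X_pow]
  exact degree_smallFactor_aux

theorem coeff_smallFactor_zero (hb : 0 < b) (hmin : IsLeast (S : Set ℤ) (-(b : ℤ))) :
    (smallFactor S ω b).coeff 0 =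
      -(PowerSeries.X * PowerSeries.C (ω (-(b : ℤ))) * excursionSeries S ω) := by
  rw [smallFactor, Polynomial.coeff_sub, Polynomial.coeff_X_pow, if_neg hb.ne,
    Polynomial.finsetSum_coeff, Finset.sum_eq_single_of_mem 0 (Finset.mem_range.2 hb), zero_sub,
    mul_assoc, Polynomial.coeff_C_mul, pow_zero, Polynomial.coeff_one_zero, mul_one]
  · congr 2
    ext n
    rw [PowerSeries.coeff_mk, PowerSeries.coeff_C_mul, coeff_walkRem_zero ω hmin hb]
  · intro j _ hj
    rw [Polynomial.coeff_C_mul, Polynomial.coeff_X_pow, if_neg hj.symm, mul_zero]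

theorem mk_eq_shift_add_sum (f : ℕ → K) (M : ℕ) :
    PowerSeries.mk f = PowerSeries.X ^ M * PowerSeries.mk (fun n => f (n + M)) +
      ∑ n ∈ range M, PowerSeries.C (f n) * PowerSeries.X ^ n := by
  ext n
  rw [map_add, map_sum, PowerSeries.coeff_mk, PowerSeries.coeff_X_pow_mul']
  simp only [PowerSeries.coeff_C_mul, PowerSeries.coeff_X_pow, mul_ite, mul_one, mul_zero,
    Finset.sum_ite_eq, Finset.mem_range, PowerSeries.coeff_mk]
  by_cases h : n < M
  · rw [if_neg h.not_ge, if_pos h, zero_add]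
  · rw [if_pos (not_lt.1 h), if_neg h, add_zero, Nat.sub_add_cancel (not_lt.1 h)]

theorem natDegree_walkRem_lt (hb : 0 < b) (n : ℕ) : (walkRem S ω b n).natDegree < b := by
  by_cases h : walkRem S ω b n = 0
  · rwa [h, Polynomial.natDegree_zero]
  · exact (Polynomial.natDegree_lt_iff_degree_lt h).2 (degree_walkRem_lt S ω b n)

/-- The kernel method: the roots of the kernel that are finite at zero are roots of
`smallFactor`. -/
theorem eval₂_smallFactor (hb : 0 < b) {u : PuiseuxSeries L} (hu : u ∈ finiteSubring L)
    (hroot : ((kernel S ω b).map (polyToPuiseux K L)).IsRoot u) :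
    (smallFactor S ω b).eval₂ (toPuiseux K L) u = 0 := by
  refine eq_zero_of_forall_pow_mul (K := K) fun M => ?_
  set t := toPuiseux K L PowerSeries.X with ht
  have key := kernel_equation ω (constToPuiseux K L) t u (isRoot_kernel_iff.1 hroot) M
  -- Cut each coefficient series of `smallFactor` at order M: by `key` the truncated part
  -- contributes t^M u^b F_M(u), and the tails carry an explicit t^M.
  refine ⟨u ^ b * (walkPoly S ω b M).eval₂ (constToPuiseux K L) u - ∑ j ∈ range b,
    t * toPuiseux K L (PowerSeries.mk fun n => (walkRem S ω b (n + M)).coeff j) * u ^ j, ?_, ?_⟩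
  · exact sub_mem (mul_mem (pow_mem hu _) (eval₂_mem_finiteSubring _ hu))
      (sum_mem fun j _ => mul_mem (mul_mem (toPuiseux_mem _) (toPuiseux_mem _)) (pow_mem hu _))
  · rw [mul_sub, ← key, smallFactor, Polynomial.eval₂_sub, Polynomial.eval₂_X_pow, sub_sub,
      Polynomial.eval₂_finsetSum, Finset.mul_sum]
    congr 1
    have h1 : ∀ n, (walkRem S ω b n).eval₂ (constToPuiseux K L) u =
        ∑ j ∈ range b, constToPuiseux K L ((walkRem S ω b n).coeff j) * u ^ j := fun n =>
      Polynomial.eval₂_eq_sum_range' _ (natDegree_walkRem_lt hb n) _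
    simp only [h1, Finset.mul_sum]
    rw [Finset.sum_comm, ← Finset.sum_add_distrib]
    refine Finset.sum_congr rfl fun j _ => ?_
    rw [mk_eq_shift_add_sum _ M]
    rw [Polynomial.eval₂_mul, Polynomial.eval₂_C, Polynomial.eval₂_X_pow]
    simp only [map_mul, map_add, map_pow, map_sum, ← ht, mul_add, add_mul, Finset.mul_sum, Finset.sum_mul]
    rw [add_comm]
    congr 1
    · refine Finset.sum_congr rfl fun n _ => ?_
      change t * (constToPuiseux K L _ * t ^ n) * u ^ j = _
      ring
    · ring

end Kernel

/-! ### Product formulas for the excursion series -/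

section Formulas

open Finset

variable {K L : Type*} [Field K] [Field L] [Algebra K L] {S : Finset ℤ} {ω : ℤ → K} {a b : ℕ}
  {U : Fin (a + b) → PuiseuxSeries L}

theorem card_filter_small : #{i : Fin (a + b) | i.val < b} = b := by
  rw [Fin.card_filter_val_lt]
  omega

theorem card_filter_large : #{i : Fin (a + b) | b ≤ i.val} = a := by
  have := Finset.card_filter_add_card_filter_not (s := (univ : Finset (Fin (a + b))))
    (fun i => i.val < b)
  simp only [not_lt, card_filter_small, Finset.card_univ, Fintype.card_fin] at this
  omega

theorem IsRootLabelling.isRoot (hU : IsRootLabelling S ω a b U) (i : Fin (a + b)) :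
    ((kernel S ω b).map (polyToPuiseux K L)).IsRoot (U i) := by
  refine Polynomial.isRoot_of_mem_roots ?_
  rw [hU.roots_eq]
  exact Multiset.mem_map_of_mem U (Finset.mem_univ_val i)

/-- A labelling lists as many roots as the degree, so the kernel splits. -/
theorem IsRootLabelling.map_kernel_eq (ha : 0 < a) (hmax : IsGreatest (S : Set ℤ) (a : ℤ))
    (hmin : IsLeast (S : Set ℤ) (-(b : ℤ))) (hωa : ω a ≠ 0) (hU : IsRootLabelling S ω a b U) :
    (kernel S ω b).map (polyToPuiseux K L) =
      Polynomial.C (-(toPuiseux K L PowerSeries.X * constToPuiseux K L (ω a))) *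
        ∏ i, (Polynomial.X - Polynomial.C (U i)) := by
  rw [← leadingCoeff_map_kernel ha hmax hmin hωa]
  conv_lhs => rw [← Polynomial.C_leadingCoeff_mul_prod_multiset_X_sub_C
    (p := (kernel S ω b).map (polyToPuiseux K L)) (by
      rw [hU.roots_eq, natDegree_map_kernel ha hmax hmin hωa]; simp)]
  rw [hU.roots_eq, Multiset.map_map]
  rfl

theorem IsRootLabelling.prod_eq (ha : 0 < a) (hb : 0 < b) (hmax : IsGreatest (S : Set ℤ) (a : ℤ))
    (hmin : IsLeast (S : Set ℤ) (-(b : ℤ))) (hωa : ω a ≠ 0) (hU : IsRootLabelling S ω a b U) :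
    constToPuiseux K L (ω (-(b : ℤ))) = (-1) ^ (a + b) * constToPuiseux K L (ω a) * ∏ i, U i := by
  have h := congrArg (fun p => Polynomial.coeff p 0) (hU.map_kernel_eq ha hmax hmin hωa)
  simp only [coeff_map_kernel_zero hb hmin, Polynomial.coeff_C_mul, Polynomial.coeff_zero_prod,
    Polynomial.coeff_sub, Polynomial.coeff_X_zero, Polynomial.coeff_C_zero, zero_sub,
    Finset.prod_neg, Finset.card_univ, Fintype.card_fin] at h
  refine mul_left_cancel₀ (toPuiseux_X_ne_zero (K := K)) ?_
  linear_combination -h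

theorem constToPuiseux_ne_zero {x : K} (hx : x ≠ 0) : constToPuiseux K L x ≠ 0 :=
  (map_ne_zero _).2 hx

theorem IsRootLabelling.ne_zero (ha : 0 < a) (hb : 0 < b) (hmax : IsGreatest (S : Set ℤ) (a : ℤ))
    (hmin : IsLeast (S : Set ℤ) (-(b : ℤ))) (hωa : ω a ≠ 0) (hωb : ω (-(b : ℤ)) ≠ 0)
    (hU : IsRootLabelling S ω a b U) (i : Fin (a + b)) : U i ≠ 0 := by
  intro h
  have := hU.prod_eq ha hb hmax hmin hωa
  rw [Finset.prod_eq_zero (Finset.mem_univ i) h, mul_zero] at this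
  exact constToPuiseux_ne_zero hωb this

/-- All labellings list the same multiset of roots, and one of them is injective. -/
theorem IsRootLabelling.injective [CharZero L] [IsAlgClosed L] (ha : 0 < a) (hb : 0 < b)
    (hmax : IsGreatest (S : Set ℤ) (a : ℤ)) (hmin : IsLeast (S : Set ℤ) (-(b : ℤ)))
    (hωa : ω a ≠ 0) (hωb : ω (-(b : ℤ)) ≠ 0) (hU : IsRootLabelling S ω a b U) :
    Function.Injective U := by
  obtain ⟨U', hU', hinj⟩ := exists_injective_isRootLabelling (L := L) ha hb hmax hmin hωa hωb
  have h : (Finset.univ.val.map U).Nodup := by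
    rw [← hU.roots_eq, hU'.roots_eq]
    exact Finset.univ.nodup.map hinj
  exact fun i j hij => Multiset.inj_on_of_nodup_map h i (Finset.mem_univ_val i) j
    (Finset.mem_univ_val j) hij

/-- Both sides are monic of degree b, so their difference has degree below b; it vanishes at the b
distinct small roots. -/
theorem IsRootLabelling.map_smallFactor_eq [CharZero L] [IsAlgClosed L] (ha : 0 < a) (hb : 0 < b)
    (hmax : IsGreatest (S : Set ℤ) (a : ℤ)) (hmin : IsLeast (S : Set ℤ) (-(b : ℤ)))
    (hωa : ω a ≠ 0) (hωb : ω (-(b : ℤ)) ≠ 0) (hU : IsRootLabelling S ω a b U) :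
    (smallFactor S ω b).map (toPuiseux K L) =
      ∏ i : Fin (a + b) with i.val < b, (Polynomial.X - Polynomial.C (U i)) := by
  have hm := (monic_smallFactor (S := S) (ω := ω) (b := b)).map (toPuiseux K L)
  have hd : ((smallFactor S ω b).map (toPuiseux K L)).degree = b := by
    rw [monic_smallFactor.degree_map, degree_smallFactor]
  have hd' : (∏ i ∈ Finset.univ.filter fun i : Fin (a + b) => i.val < b,
      (Polynomial.X - Polynomial.C (U i))).degree = (b : WithBot ℕ) := by
    rw [Polynomial.degree_prod]
    simp only [Polynomial.degree_X_sub_C, Finset.sum_const, card_filter_small, nsmul_eq_mul,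
      mul_one]
  refine Polynomial.eq_of_degree_sub_lt_of_eval_index_eq (Finset.univ.filter fun i : Fin (a + b) => i.val < b)
    (hU.injective ha hb hmax hmin hωa hωb).injOn ?_ fun i hi => ?_
  · rw [card_filter_small, ← hd]
    refine Polynomial.degree_sub_lt_left (hd.trans hd'.symm) hm.ne_zero ?_
    rw [hm.leadingCoeff, (Polynomial.monic_prod_X_sub_C _ _).leadingCoeff]
  · rw [Polynomial.eval_map, eval₂_smallFactor hb (hU.small i (Finset.mem_filter.1 hi).2)
      (hU.isRoot i), Polynomial.eval_prod, Finset.prod_eq_zero hi (by simp)]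

/-- The generating function of excursions in terms of the small roots. -/
theorem IsRootLabelling.excursionSeries_eq_small [CharZero L] [IsAlgClosed L] (ha : 0 < a)
    (hb : 0 < b) (hmax : IsGreatest (S : Set ℤ) (a : ℤ)) (hmin : IsLeast (S : Set ℤ) (-(b : ℤ)))
    (hωa : ω a ≠ 0) (hωb : ω (-(b : ℤ)) ≠ 0) (hU : IsRootLabelling S ω a b U) :
    toPuiseux K L PowerSeries.X * constToPuiseux K L (ω (-(b : ℤ))) *
      toPuiseux K L (excursionSeries S ω) =
      (-1) ^ (b + 1) * ∏ i : Fin (a + b) with i.val < b, U i := by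
  have h := congrArg (fun p => Polynomial.coeff p 0)
    (hU.map_smallFactor_eq ha hb hmax hmin hωa hωb)
  simp only [Polynomial.coeff_map, coeff_smallFactor_zero hb hmin, Polynomial.coeff_zero_prod,
    Polynomial.coeff_sub, Polynomial.coeff_X_zero, Polynomial.coeff_C_zero, zero_sub,
    Finset.prod_neg, card_filter_small, map_neg, map_mul] at h
  rw [pow_succ]
  exact (neg_eq_iff_eq_neg.1 h).trans (by ring)

/-- The generating function of excursions in terms of the large roots. -/
theorem IsRootLabelling.excursionSeries_mul_large [CharZero L] [IsAlgClosed L] (ha : 0 < a)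
    (hb : 0 < b) (hmax : IsGreatest (S : Set ℤ) (a : ℤ)) (hmin : IsLeast (S : Set ℤ) (-(b : ℤ)))
    (hωa : ω a ≠ 0) (hωb : ω (-(b : ℤ)) ≠ 0) (hU : IsRootLabelling S ω a b U) :
    toPuiseux K L PowerSeries.X * constToPuiseux K L (ω a) *
      (∏ i : Fin (a + b) with b ≤ i.val, U i) * toPuiseux K L (excursionSeries S ω) =
      (-1) ^ (a + 1) := by
  have h1 := hU.excursionSeries_eq_small ha hb hmax hmin hωa hωb
  have h2 := hU.prod_eq ha hb hmax hmin hωa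
  rw [← Finset.prod_filter_mul_prod_filter_not univ (fun i : Fin (a + b) => i.val < b)] at h2
  simp only [not_lt] at h2
  have h3 : ∏ i : Fin (a + b) with i.val < b, U i ≠ 0 :=
    Finset.prod_ne_zero_iff.2 fun i _ => hU.ne_zero ha hb hmax hmin hωa hωb i
  -- Multiplied by the small roots, the left side contains the product of all roots, which Vieta
  -- expresses through ω_{-b}/ω_a.
  refine mul_left_cancel₀ h3 ?_
  rw [h2] at h1
  have h4 : ((-1) ^ (a + b) * (-1) ^ (a + b) : PuiseuxSeries L) = 1 := by
    rw [← mul_pow]; simp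
  have h5 : ((-1) ^ (b + 1) * (-1) ^ (a + b) : PuiseuxSeries L) = (-1) ^ (a + 1) := by
    rw [← pow_add, show b + 1 + (a + b) = a + 1 + 2 * b by ring, pow_add, pow_mul]; simp
  linear_combination (-1) ^ (a + b) * h1 - (toPuiseux K L PowerSeries.X *
    constToPuiseux K L (ω a) * (∏ i : Fin (a + b) with b ≤ i.val, U i) *
    toPuiseux K L (excursionSeries S ω) * ∏ i : Fin (a + b) with i.val < b, U i) * h4 +
    (∏ i : Fin (a + b) with i.val < b, U i) * h5

end Formulas

/-! ### Symmetric functions of the roots -/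

section Symmetric

open Finset

/-- By the fundamental theorem, p is a polynomial over R in the elementary symmetric polynomials. -/
theorem aeval_mem_range_of_isSymmetric {R A : Type*} [CommRing R] [CommRing A] [Algebra R A] {n : ℕ}
    (U : Fin n → A) {p : MvPolynomial (Fin n) R} (hp : p.IsSymmetric)
    (h : ∀ k ≤ n, (Finset.univ.val.map U).esymm k ∈ (algebraMap R A).range) :
    MvPolynomial.aeval U p ∈ (algebraMap R A).range := by
  obtain ⟨q, hq⟩ := MvPolynomial.esymmAlgHom_surjective (σ := Fin n) (R := R) (n := n) (by simp)
    ⟨p, hp⟩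
  have hq' : p = MvPolynomial.aeval (fun i : Fin n => MvPolynomial.esymm (Fin n) R (i + 1)) q := by
    rw [← MvPolynomial.esymmAlgHom_apply, hq]
  choose c hc using fun i : Fin n => h (i + 1) i.2
  refine ⟨MvPolynomial.aeval c q, ?_⟩
  rw [hq', ← AlgHom.comp_apply, MvPolynomial.comp_aeval,
    ← MvPolynomial.aeval_algebraMap_apply]
  congr 1
  refine congrArg MvPolynomial.aeval (funext fun i => ?_)
  rw [Function.comp_apply, hc, MvPolynomial.aeval_esymm_eq_multiset_esymm]

/-- The polynomial `∏_{|I| = a} (1 + κ X_I z)` in `z`, where `X_I = ∏_{i ∈ I} X_i`. -/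
def subsetProduct {R : Type*} [CommRing R] (n a : ℕ) (κ : R) : (MvPolynomial (Fin n) R)[X] :=
  ∏ I ∈ powersetCard a (univ : Finset (Fin n)),
    (1 + Polynomial.C (MvPolynomial.C κ * ∏ i ∈ I, MvPolynomial.X i) * Polynomial.X)

/-- Permuting the variables permutes the a-element subsets, hence the factors. -/
theorem isSymmetric_coeff_subsetProduct {R : Type*} [CommRing R] (n a : ℕ) (κ : R) (k : ℕ) :
    ((subsetProduct n a κ).coeff k).IsSymmetric := by
  intro σ
  have h : (subsetProduct n a κ).map (MvPolynomial.rename σ : _ →ₐ[R] _).toRingHom =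
      subsetProduct n a κ := by
    rw [subsetProduct, Polynomial.map_prod]
    refine Finset.prod_equiv σ.finsetCongr (fun I => by simp) fun I _ => ?_
    rw [Polynomial.map_add, Polynomial.map_one, Polynomial.map_mul, Polynomial.map_C,
      Polynomial.map_X]
    congr 3
    change MvPolynomial.rename σ _ = _
    simp [Finset.prod_map]
  conv_rhs => rw [← h, Polynomial.coeff_map]
  rfl

variable {K L : Type*} [Field K] [Field L] [Algebra K L]

variable (K L) in
/-- The Laurent polynomials in `t` over `K`, as a subring of the Puiseux series over `L`. -/
def laurentSubring : Subring (PuiseuxSeries L) where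
  carrier := {f | ∃ (M : ℕ) (p : K[X]),
    toPuiseux K L PowerSeries.X ^ M * f = polyToPuiseux K L p}
  zero_mem' := ⟨0, 0, by simp⟩
  one_mem' := ⟨0, 1, by simp⟩
  add_mem' := by
    rintro f g ⟨M, p, hp⟩ ⟨N, q, hq⟩
    refine ⟨M + N, Polynomial.X ^ N * p + Polynomial.X ^ M * q, ?_⟩
    rw [map_add, map_mul, map_mul, map_pow, map_pow, polyToPuiseux_X, ← hp, ← hq]
    ring
  mul_mem' := by
    rintro f g ⟨M, p, hp⟩ ⟨N, q, hq⟩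
    refine ⟨M + N, p * q, ?_⟩
    rw [map_mul, ← hp, ← hq]
    ring
  neg_mem' := by
    rintro f ⟨M, p, hp⟩
    exact ⟨M, -p, by rw [map_neg, ← hp, mul_neg]⟩

theorem polyToPuiseux_mem_laurentSubring (p : K[X]) :
    polyToPuiseux K L p ∈ laurentSubring K L := ⟨0, p, by simp⟩

theorem toPuiseux_X_inv_mem_laurentSubring :
    (toPuiseux K L PowerSeries.X)⁻¹ ∈ laurentSubring K L :=
  ⟨1, 1, by rw [pow_one, mul_inv_cancel₀ toPuiseux_X_ne_zero, map_one]⟩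

theorem constToPuiseux_mem_laurentSubring (x : K) :
    constToPuiseux K L x ∈ laurentSubring K L := by
  rw [← polyToPuiseux_C]
  exact polyToPuiseux_mem_laurentSubring _

variable {S : Finset ℤ} {ω : ℤ → K} {a b : ℕ} {U : Fin (a + b) → PuiseuxSeries L}

/-- Vieta divides the coefficients of the kernel by the leading one, -t ω_a, a unit among Laurent
polynomials. -/
theorem IsRootLabelling.esymm_mem (ha : 0 < a) (hmax : IsGreatest (S : Set ℤ) (a : ℤ))
    (hmin : IsLeast (S : Set ℤ) (-(b : ℤ))) (hωa : ω a ≠ 0) (hU : IsRootLabelling S ω a b U)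
    {k : ℕ} (hk : k ≤ a + b) : (Finset.univ.val.map U).esymm k ∈ laurentSubring K L := by
  have hd := natDegree_map_kernel (L := L) ha hmax hmin hωa
  have h := Polynomial.coeff_eq_esymm_roots_of_card
    (p := (kernel S ω b).map (polyToPuiseux K L)) (k := a + b - k)
    (by rw [hd, hU.roots_eq]; simp) (by omega)
  rw [hd, hU.roots_eq, leadingCoeff_map_kernel ha hmax hmin hωa, Nat.sub_sub_self hk,
    Polynomial.coeff_map] at h
  have h1 : (Finset.univ.val.map U).esymm k = -((-1) ^ k * (toPuiseux K L PowerSeries.X)⁻¹ *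
      constToPuiseux K L (ω a)⁻¹ * polyToPuiseux K L ((kernel S ω b).coeff (a + b - k))) := by
    have h2 : ((-1) ^ k * (-1) ^ k : PuiseuxSeries L) = 1 := by
      rw [← mul_pow]; simp
    have h3 : constToPuiseux K L (ω a) ≠ 0 := constToPuiseux_ne_zero hωa
    have h4 : toPuiseux K L PowerSeries.X ≠ 0 := toPuiseux_X_ne_zero
    rw [h, map_inv₀]
    field_simp
    linear_combination -(Finset.univ.val.map U).esymm k * h2
  rw [h1]
  exact neg_mem (mul_mem (mul_mem (mul_mem (pow_mem (neg_mem (one_mem _)) _)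
    toPuiseux_X_inv_mem_laurentSubring) (constToPuiseux_mem_laurentSubring _))
    (polyToPuiseux_mem_laurentSubring _))

theorem IsRootLabelling.coeff_productD_mem_laurentSubring (ha : 0 < a)
    (hmax : IsGreatest (S : Set ℤ) (a : ℤ)) (hmin : IsLeast (S : Set ℤ) (-(b : ℤ))) (hωa : ω a ≠ 0)
    (hU : IsRootLabelling S ω a b U) (k : ℕ) :
    (productD ω a b U).coeff k ∈ laurentSubring K L := by
  have hκ : (-1) ^ a * toPuiseux K L PowerSeries.X * toPuiseux K L (PowerSeries.C (ω a)) ∈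
      laurentSubring K L := by
    rw [← polyToPuiseux_X]
    exact mul_mem (mul_mem (pow_mem (neg_mem (one_mem _)) _) (polyToPuiseux_mem_laurentSubring _))
      (constToPuiseux_mem_laurentSubring (ω a))
  have h := aeval_mem_range_of_isSymmetric (R := laurentSubring K L) U
    (isSymmetric_coeff_subsetProduct (a + b) a ⟨_, hκ⟩ k)
    fun j hj => ⟨⟨_, hU.esymm_mem ha hmax hmin hωa hj⟩, rfl⟩
  have h1 : productD ω a b U = (subsetProduct (a + b) a (⟨_, hκ⟩ : laurentSubring K L)).map
      (MvPolynomial.aeval U : _ →ₐ[laurentSubring K L] _).toRingHom := by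
    rw [productD, subsetProduct, Polynomial.map_prod]
    refine Finset.prod_congr rfl fun I _ => ?_
    rw [Polynomial.map_add, Polynomial.map_one, Polynomial.map_mul, Polynomial.map_C,
      Polynomial.map_X]
    congr 3
    change _ = MvPolynomial.aeval U _
    rw [map_mul, map_prod, MvPolynomial.aeval_C]
    simp only [MvPolynomial.aeval_X]
    rfl
  rw [h1, Polynomial.coeff_map]
  obtain ⟨x, hx⟩ := h
  exact hx ▸ x.2

theorem IsRootLabelling.natDegree_productD (ha : 0 < a) (hb : 0 < b)
    (hmax : IsGreatest (S : Set ℤ) (a : ℤ)) (hmin : IsLeast (S : Set ℤ) (-(b : ℤ)))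
    (hωa : ω a ≠ 0) (hωb : ω (-(b : ℤ)) ≠ 0) (hU : IsRootLabelling S ω a b U) :
    (productD ω a b U).natDegree = (a + b).choose a := by
  have h0 : ∀ I : Finset (Fin (a + b)), (-1) ^ a * toPuiseux K L PowerSeries.X *
      toPuiseux K L (PowerSeries.C (ω a)) * ∏ i ∈ I, U i ≠ 0 := by
    intro I
    have h1 : toPuiseux K L (PowerSeries.C (ω a)) ≠ 0 := by
      rw [toPuiseux_C]
      exact constToPuiseux_ne_zero hωa
    have h2 : ∏ i ∈ I, U i ≠ 0 :=
      Finset.prod_ne_zero_iff.2 fun i _ => hU.ne_zero ha hb hmax hmin hωa hωb i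
    have h3 : ((-1) ^ a : PuiseuxSeries L) ≠ 0 := pow_ne_zero _ (neg_ne_zero.2 one_ne_zero)
    exact mul_ne_zero (mul_ne_zero (mul_ne_zero h3 toPuiseux_X_ne_zero) h1) h2
  have h1 : ∀ I ∈ powersetCard a (univ : Finset (Fin (a + b))),
      (1 + Polynomial.C ((-1) ^ a * toPuiseux K L PowerSeries.X *
        toPuiseux K L (PowerSeries.C (ω a)) * ∏ i ∈ I, U i) * Polynomial.X).natDegree = 1 := by
    intro I _
    rw [add_comm, ← Polynomial.C_1]
    exact Polynomial.natDegree_linear (h0 I)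
  rw [productD, Polynomial.natDegree_prod, Finset.sum_congr rfl h1]
  · simp
  · intro I hI h0
    have := h1 I hI
    rw [h0, Polynomial.natDegree_zero] at this
    exact zero_ne_one this

variable [CharZero L] [IsAlgClosed L]

/-- For the set of all large roots the product is ±1/E, finite since E has constant term 1. Any
other I is reached by multiplying by small roots and by inverses of the missing large roots, all
finite. -/
theorem IsRootLabelling.mul_prod_mem_finiteSubring (ha : 0 < a) (hb : 0 < b)
    (hmax : IsGreatest (S : Set ℤ) (a : ℤ)) (hmin : IsLeast (S : Set ℤ) (-(b : ℤ)))
    (hωa : ω a ≠ 0) (hωb : ω (-(b : ℤ)) ≠ 0) (hU : IsRootLabelling S ω a b U)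
    (I : Finset (Fin (a + b))) :
    toPuiseux K L PowerSeries.X * constToPuiseux K L (ω a) * ∏ i ∈ I, U i ∈ finiteSubring L := by
  have hE : excursionSeries S ω * (excursionSeries S ω)⁻¹ = 1 :=
    PowerSeries.mul_inv_cancel _ (by rw [constantCoeff_excursionSeries]; exact one_ne_zero)
  have hE' := congrArg (toPuiseux K L) hE
  rw [map_mul, map_one] at hE'
  have h1 := hU.excursionSeries_mul_large ha hb hmax hmin hωa hωb
  have h2 := Finset.prod_inter_mul_prod_sdiff (univ.filter fun i : Fin (a + b) => b ≤ i.val) I U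
  have h3 := Finset.prod_filter_mul_prod_filter_not I (fun i : Fin (a + b) => i.val < b) U
  simp only [not_lt] at h3
  have h4 : (univ.filter fun i : Fin (a + b) => b ≤ i.val) ∩ I = I.filter fun i => b ≤ i.val := by
    ext i
    simp [and_comm]
  rw [h4] at h2
  set T := (univ.filter fun i : Fin (a + b) => b ≤ i.val) \ I
  have h5 : (∏ i ∈ T, U i) * ∏ i ∈ T, (U i)⁻¹ = 1 := by
    rw [← Finset.prod_mul_distrib]
    exact Finset.prod_eq_one fun i _ =>
      mul_inv_cancel₀ (hU.ne_zero ha hb hmax hmin hωa hωb i)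
  have h6 : toPuiseux K L PowerSeries.X * constToPuiseux K L (ω a) * ∏ i ∈ I, U i =
      (-1) ^ (a + 1) * toPuiseux K L (excursionSeries S ω)⁻¹ *
        (∏ i ∈ I with i.val < b, U i) * ∏ i ∈ T, (U i)⁻¹ := by
    rw [← h1, ← h2, ← h3]
    linear_combination (norm := ring_nf) -(toPuiseux K L PowerSeries.X * constToPuiseux K L (ω a) *
      (∏ i ∈ I with i.val < b, U i) * ∏ i ∈ I with b ≤ i.val, U i) *
      (h5 + (∏ i ∈ T, U i) * (∏ i ∈ T, (U i)⁻¹) * hE')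
  rw [h6]
  refine mul_mem (mul_mem (mul_mem (pow_mem (neg_mem (one_mem _)) _) (toPuiseux_mem _))
    (prod_mem fun i hi => hU.small i (Finset.mem_filter.1 hi).2)) (prod_mem fun i hi => ?_)
  exact inv_mem_finiteSubring
    (hU.large i (Finset.mem_filter.1 (Finset.mem_sdiff.1 hi).1).2)

theorem IsRootLabelling.coeff_productD_mem_finiteSubring (ha : 0 < a) (hb : 0 < b)
    (hmax : IsGreatest (S : Set ℤ) (a : ℤ)) (hmin : IsLeast (S : Set ℤ) (-(b : ℤ)))
    (hωa : ω a ≠ 0) (hωb : ω (-(b : ℤ)) ≠ 0) (hU : IsRootLabelling S ω a b U) (k : ℕ) :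
    (productD ω a b U).coeff k ∈ finiteSubring L := by
  have h : productD ω a b U ∈ Polynomial.lifts (finiteSubring L).subtype := by
    refine Subsemiring.prod_mem _ fun I _ => add_mem (one_mem _) (mul_mem ?_ ?_)
    · refine Polynomial.C'_mem_lifts ⟨⟨_, ?_⟩, rfl⟩
      have h := mul_mem (pow_mem (neg_mem (one_mem (finiteSubring L))) a)
        (hU.mul_prod_mem_finiteSubring ha hb hmax hmin hωa hωb I)
      rwa [← mul_assoc, ← mul_assoc] at h
    · exact Polynomial.X_mem_lifts _
  obtain ⟨x, hx⟩ := (Polynomial.lifts_iff_coeff_lifts _).1 h k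
  exact hx ▸ x.2

/-- A Laurent polynomial without negative powers of t is a polynomial. -/
theorem IsRootLabelling.exists_polynomial (ha : 0 < a) (hb : 0 < b)
    (hmax : IsGreatest (S : Set ℤ) (a : ℤ)) (hmin : IsLeast (S : Set ℤ) (-(b : ℤ)))
    (hωa : ω a ≠ 0) (hωb : ω (-(b : ℤ)) ≠ 0) (hU : IsRootLabelling S ω a b U) :
    ∃ D : K[X][X], D.map (polyToPuiseux K L) = productD ω a b U := by
  refine (Polynomial.mem_lifts _).1 ((Polynomial.lifts_iff_coeff_lifts _).2 fun k => ?_)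
  obtain ⟨M, p, hp⟩ := hU.coeff_productD_mem_laurentSubring ha hmax hmin hωa k
  exact mem_range_polyToPuiseux
    (hU.coeff_productD_mem_finiteSubring ha hb hmax hmin hωa hωb k) hp

theorem IsRootLabelling.eval_productD (ha : 0 < a) (hb : 0 < b)
    (hmax : IsGreatest (S : Set ℤ) (a : ℤ)) (hmin : IsLeast (S : Set ℤ) (-(b : ℤ)))
    (hωa : ω a ≠ 0) (hωb : ω (-(b : ℤ)) ≠ 0) (hU : IsRootLabelling S ω a b U) :
    (productD ω a b U).eval (toPuiseux K L (excursionSeries S ω)) = 0 := by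
  rw [productD, Polynomial.eval_prod]
  -- The factor that vanishes is the one whose I consists of the large roots.
  refine Finset.prod_eq_zero (i := univ.filter fun i : Fin (a + b) => b ≤ i.val)
    (Finset.mem_powersetCard.2 ⟨Finset.subset_univ _, card_filter_large⟩) ?_
  have h1 := hU.excursionSeries_mul_large ha hb hmax hmin hωa hωb
  have h2 : ((-1) ^ a * (-1) ^ a : PuiseuxSeries L) = 1 := by
    rw [← mul_pow]; simp
  rw [Polynomial.eval_add, Polynomial.eval_one, Polynomial.eval_mul, Polynomial.eval_C,
    Polynomial.eval_X]
  change 1 + (-1) ^ a * toPuiseux K L PowerSeries.X * constToPuiseux K L (ω a) * _ * _ = 0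
  rw [pow_succ] at h1
  linear_combination (-1) ^ a * h1 - h2

theorem IsRootLabelling.exists_annihilator (ha : 0 < a) (hb : 0 < b)
    (hmax : IsGreatest (S : Set ℤ) (a : ℤ)) (hmin : IsLeast (S : Set ℤ) (-(b : ℤ)))
    (hωa : ω a ≠ 0) (hωb : ω (-(b : ℤ)) ≠ 0) (hU : IsRootLabelling S ω a b U) :
    ∃ D : K[X][X], D.map (polyToPuiseux K L) = productD ω a b U ∧
      D.natDegree = (a + b).choose a ∧
      D.eval₂ Polynomial.coeToPowerSeries.ringHom (excursionSeries S ω) = 0 := by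
  obtain ⟨D, hD⟩ := hU.exists_polynomial ha hb hmax hmin hωa hωb
  refine ⟨D, hD, ?_, toPuiseux_injective (L := L) ?_⟩
  · rw [← hU.natDegree_productD ha hb hmax hmin hωa hωb, ← hD,
      Polynomial.natDegree_map_eq_of_injective polyToPuiseux_injective]
  · rw [Polynomial.hom_eval₂, map_zero, ← hU.eval_productD ha hb hmax hmin hωa hωb, ← hD,
      Polynomial.eval_map, polyToPuiseux]

end Symmetric

/-! ### Algebraicity over 𝕂(t) -/

open RatFunc in
/-- A power series annihilated by a nonzero polynomial of degree `d` over `K[t]` is algebraic of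
degree at most `d` over `K(t)`. -/
theorem isAlgebraic_and_natDegree_minpoly_le {K : Type*} [Field K] {D : K[X][X]} (hD : D ≠ 0)
    {f : K⟦X⟧} (h : D.eval₂ Polynomial.coeToPowerSeries.ringHom f = 0) :
    IsAlgebraic (RatFunc K) (HahnSeries.ofPowerSeries ℤ K f) ∧
      (minpoly (RatFunc K) (HahnSeries.ofPowerSeries ℤ K f)).natDegree ≤ D.natDegree := by
  have hinj : Function.Injective (algebraMap K[X] (RatFunc K)) :=
    IsFractionRing.injective K[X] (RatFunc K)
  have h0 : D.map (algebraMap K[X] (RatFunc K)) ≠ 0 :=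
    (Polynomial.map_ne_zero_iff hinj).2 hD
  have hcomp : (algebraMap (RatFunc K) (HahnSeries ℤ K)).comp (algebraMap K[X] (RatFunc K)) =
      (HahnSeries.ofPowerSeries ℤ K).comp Polynomial.coeToPowerSeries.ringHom := by
    rw [← IsScalarTower.algebraMap_eq]
    refine RingHom.ext fun p => ?_
    exact Polynomial.algebraMap_hahnSeries_apply _ p
  have h1 : Polynomial.aeval (HahnSeries.ofPowerSeries ℤ K f)
      (D.map (algebraMap K[X] (RatFunc K))) = 0 := by
    rw [Polynomial.aeval_def, Polynomial.eval₂_map, hcomp, ← Polynomial.hom_eval₂, h, map_zero]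
  refine ⟨⟨_, h0, h1⟩, ?_⟩
  rw [← Polynomial.natDegree_map_eq_of_injective hinj D]
  exact Polynomial.natDegree_le_natDegree (minpoly.degree_le_of_ne_zero _ _ h0 h1)

end

end DiscreteExcursion

open DiscreteExcursion RatFunc in
theorem mainTheorem1 {K L : Type*} [Field K] [CharZero K] [Field L] [Algebra K L]
    [IsAlgClosure K L] (S : Finset ℤ) (ω : ℤ → K) (a b : ℕ) (ha : 0 < a) (hb : 0 < b)
    (hmax : IsGreatest (S : Set ℤ) (a : ℤ)) (hmin : IsLeast (S : Set ℤ) (-(b : ℤ)))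
    (hωa : ω a ≠ 0) (hωb : ω (-(b : ℤ)) ≠ 0) :
    -- `E` is algebraic over `𝕂(t)`, of degree at most `binom(a+b, a)`
    (IsAlgebraic (RatFunc K) (HahnSeries.ofPowerSeries ℤ K (excursionSeries S ω)) ∧
      (minpoly (RatFunc K) (HahnSeries.ofPowerSeries ℤ K (excursionSeries S ω))).natDegree
        ≤ (a + b).choose a) ∧
    -- the kernel has exactly `b` small and `a` large roots
    (∃ U : Fin (a + b) → PuiseuxSeries L, IsRootLabelling S ω a b U) ∧
    ∀ U : Fin (a + b) → PuiseuxSeries L, IsRootLabelling S ω a b U →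
      -- the two expressions of `E`
      toPuiseux K L (excursionSeries S ω) =
        (-1) ^ (b + 1) / (toPuiseux K L PowerSeries.X *
            toPuiseux K L (PowerSeries.C (ω (-(b : ℤ))))) *
          ∏ i : Fin (a + b) with i.val < b, U i ∧
      toPuiseux K L (excursionSeries S ω) =
        (-1) ^ (a + 1) / (toPuiseux K L PowerSeries.X *
            toPuiseux K L (PowerSeries.C (ω a))) *
          ∏ i : Fin (a + b) with b ≤ i.val, 1 / U i ∧
      -- `D(t, z)` is a polynomial in `t` (inner variable) and `z` (outer variable)
      ∃ D : Polynomial (Polynomial K),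
        D.map (polyToPuiseux K L) = productD ω a b U ∧
        D.natDegree = (a + b).choose a ∧
        D.eval₂ Polynomial.coeToPowerSeries.ringHom (excursionSeries S ω) = 0 := by
  have : IsAlgClosed L := IsAlgClosure.isAlgClosed K
  have : CharZero L := charZero_of_injective_algebraMap (algebraMap K L).injective
  obtain ⟨U₀, hU₀, -⟩ := exists_injective_isRootLabelling (L := L) ha hb hmax hmin hωa hωb
  refine ⟨?_, ⟨U₀, hU₀⟩, fun U hU => ⟨?_, ?_, hU.exists_annihilator ha hb hmax hmin hωa hωb⟩⟩
  · obtain ⟨D, -, hd, hD⟩ := hU₀.exists_annihilator ha hb hmax hmin hωa hωb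
    rw [← hd]
    refine isAlgebraic_and_natDegree_minpoly_le ?_ hD
    -- The zero polynomial has `natDegree` 0, whereas the binomial coefficient is positive.
    rintro rfl
    exact (Nat.choose_pos (Nat.le_add_right a b)).ne hd
  · have h := hU.excursionSeries_eq_small ha hb hmax hmin hωa hωb
    have h1 : toPuiseux K L PowerSeries.X ≠ 0 := toPuiseux_X_ne_zero
    have h2 : toPuiseux K L (PowerSeries.C (ω (-(b : ℤ)))) ≠ 0 := by
      rw [toPuiseux_C]
      exact constToPuiseux_ne_zero hωb
    rw [div_mul_eq_mul_div, eq_div_iff (mul_ne_zero h1 h2), ← h, mul_comm]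
    rfl
  · have h := hU.excursionSeries_mul_large ha hb hmax hmin hωa hωb
    have h1 : toPuiseux K L PowerSeries.X ≠ 0 := toPuiseux_X_ne_zero
    have h2 : toPuiseux K L (PowerSeries.C (ω a)) ≠ 0 := by
      rw [toPuiseux_C]
      exact constToPuiseux_ne_zero hωa
    have h3 : ∏ i : Fin (a + b) with b ≤ i.val, U i ≠ 0 :=
      Finset.prod_ne_zero_iff.2 fun i _ => hU.ne_zero ha hb hmax hmin hωa hωb i
    simp only [one_div, Finset.prod_inv_distrib]
    rw [← div_eq_mul_inv, div_div, eq_div_iff (mul_ne_zero (mul_ne_zero h1 h2) h3), ← h, mul_comm]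
    rfl
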